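/- Let $\Bbbk$ be an algebraically closed field of characteristic zero and $G$ a finite group with center $Z(G)$, derived subgroup $G'$, and group of linear characters $\widehat G=\mathrm{Hom}(G,\Bbbk^\times)$. Let $\mathcal D(G)$ be the Drinfel'd double: it has basis $e_g\# h$ ($g,h\in G$), product $(e_g\# x)(e_h\# y)=\delta_{g,xhx^{-1}}\,e_g\# xy$, unit $\sum_g e_g\#1$, coproduct $\Delta(e_g\# h)=\sum_{ab=g}(e_b\# h)\otimes(e_a\# h)$, counit $e_g\# h\mapsto\delta_{g,1}$. Write $\varepsilon=\sum_g e_g$ and $\chi\# g=\sum_x\chi(x)\,e_x\# g$. The group-like elements of $\mathcal D(G)$ are exactly the $\chi\# g$ with $\chi\in\widehat G$, $g\in G$, and form a group identified with $\Gamma=\widehat G\times G$. Let $N$ be the kernel of the restriction map $\mathrm{Aut}(\mathcal D(G))\to\mathrm{Aut}(\widehat G\times G)$, where $\mathrm{Aut}(\mathcal D(G))$ is the group of Hopf algebra automorphisms. For $\psi\in\mathrm{Aut}(\mathcal D(G))$ put $u(a)=(\mathrm{id}\otimes\varepsilon)\psi(a\#1)$ for $a\in\Bbbk^G$, and $r(g)=(\mathrm{id}\otimes\varepsilon)\psi(\varepsilon\#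 g)$, $v(g)=(\mathrm{ev}_1\otimes\mathrm{id})\psi(\varepsilon\# g)$ for $g\in G$. Let $\Lambda_c(G)$ be the set of those $\psi$ with $r$ trivial ($r(g)=\varepsilon$ for all $g$) and $v=\mathrm{id}$, and $\Lambda(G)\subseteq\Lambda_c(G)$ the set of those for which moreover $u=\mathrm{id}$. Let $\mathrm{Aut}_c(G)=\{\phi\in\mathrm{Aut}(G): \phi(g)g^{-1}\in Z(G)\ \forall g\}$ and $\mathrm{Aut}_{c'}(G)=\{\phi\in\mathrm{Aut}_c(G): \phi(g^{-1})g\in Z(G)\cap G'\ \forall g\}$; let $w\in\mathrm{Aut}_{c'}(G)$ act on the group $\mathrm{Hom}(Z(G)\cap G',Z(G))$ by $f\mapsto f\circ w^{-1}$. **Theorem.** There is an isomorphism of groups $$N\;\cong\;\mathrm{Aut}_{c'}(G)\ltimes\mathrm{Hom}(Z(G)\cap G',Z(G)),$$ under which $w\in\mathrm{Aut}_{c'}(G)$ corresponds to the automorphism $e_g\# h\mapsto e_{w(g)}\# h$, and $\mathrm{Hom}(Z(G)\cap G',Z(G))$ corresponds to $N\cap\Lambda(G)$. Moreover: 1. $N=1$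 if and only if $Z(G)\cap G'=1$. In particular, if $G$ is abelian or $Z(G)=1$, then $N=1$. 2. $Z(G)\le G'$ if and only if $N=\Lambda_c(G)$; and if $Z(G)\le G'$, then $N\ne1$ if and only if $Z(G)\neq1$. -/

import Mathlib

open scoped TensorProduct

noncomputable section

/-- The underlying space of the Drinfel'd double `D(G)`, with basis `e_g # h` indexed by the pairs
`(g, h)`; that is `k^G ⊗ kG`. -/
def DrinfeldDouble (k G : Type*) [Field k] : Type _ := (G × G) →₀ k

namespace DrinfeldDouble

section Basic

variable {k G : Type*} [Field k]

instance : AddCommGroup (DrinfeldDouble k G) := inferInstanceAs (AddCommGroup ((G × G) →₀ k))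
instance : Module k (DrinfeldDouble k G) := inferInstanceAs (Module k ((G × G) →₀ k))

/-- The basis element `e_g # h`. -/
def basisElem (g h : G) : DrinfeldDouble k G := Finsupp.single (g, h) (1 : k)

/-- The linear map with prescribed values on the basis elements `e_g # h`. -/
def lift {M : Type*} [AddCommGroup M] [Module k M] (f : G → G → M) : DrinfeldDouble k G →ₗ[k] M :=
  Finsupp.linearCombination k (fun p : G × G => f p.1 p.2)

@[simp] lemma lift_basisElem {M : Type*} [AddCommGroup M] [Module k M] (f : G → G → M) (g h : G) :
    lift f (basisElem g h : DrinfeldDouble k G) = f g h :=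
  (Finsupp.linearCombination_single k (1 : k) (g, h)).trans (one_smul k _)

lemma lhom_ext {M : Type*} [AddCommGroup M] [Module k M]
    {f f' : DrinfeldDouble k G →ₗ[k] M} (h : ∀ a b, f (basisElem a b) = f' (basisElem a b)) :
    f = f' :=
  Finsupp.lhom_ext' fun p => LinearMap.ext_ring (h p.1 p.2)

/-- The coefficient of a vector at `e_g # h`. -/
def coef (g h : G) : DrinfeldDouble k G →ₗ[k] k := Finsupp.lapply (g, h)

lemma coef_basisElem [DecidableEq G] (g h a b : G) :
    coef g h (basisElem a b : DrinfeldDouble k G) = if a = g ∧ b = h then 1 else 0 := by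
  have : coef g h (basisElem a b : DrinfeldDouble k G) =
      (Finsupp.single (a, b) (1 : k) : (G × G) →₀ k) (g, h) := rfl
  rw [this, Finsupp.single_apply]
  simp only [Prod.mk.injEq]

lemma ext_coef {x y : DrinfeldDouble k G} (h : ∀ a b, coef a b x = coef a b y) : x = y :=
  Finsupp.ext fun p => h p.1 p.2

end Basic

section One

variable {k G : Type*} [Field k] [Group G] [Fintype G]

/-- The identity is `ε # 1 = ∑ g, e_g # 1`. -/
instance : One (DrinfeldDouble k G) := ⟨∑ g : G, basisElem g 1⟩

lemma one_def : (1 : DrinfeldDouble k G) = ∑ g : G, basisElem g 1 := rfl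

end One

section Alg

variable {k G : Type*} [Field k] [Group G] [DecidableEq G]

/-- Multiplication: `(e_g # x) (e_h # y) = δ_{g, x h x⁻¹} e_g # x y`. -/
def mulLin : DrinfeldDouble k G →ₗ[k] DrinfeldDouble k G →ₗ[k] DrinfeldDouble k G :=
  lift fun g x => lift fun h y => if g = x * h * x⁻¹ then basisElem g (x * y) else 0

instance : Mul (DrinfeldDouble k G) := ⟨fun a b => mulLin a b⟩

lemma mul_def (a b : DrinfeldDouble k G) : a * b = mulLin a b := rfl

lemma basisElem_mul (g x h y : G) : (basisElem g x * basisElem h y : DrinfeldDouble k G) =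
    if g = x * h * x⁻¹ then basisElem g (x * y) else 0 := by
  simp [mul_def, mulLin]

lemma mul_assoc_aux (a b c : DrinfeldDouble k G) : a * b * c = a * (b * c) := by
  have : (LinearMap.llcomp k _ _ _ (mulLin (k := k) (G := G))) ∘ₗ mulLin =
      (LinearMap.llcomp k _ _ _).flip mulLin ∘ₗ (LinearMap.llcomp k _ _ _) ∘ₗ
        (mulLin (k := k) (G := G)) := by
    refine lhom_ext fun g x => lhom_ext fun h y => lhom_ext fun l z => ?_
    change basisElem g x * basisElem h y * basisElem l z =
      basisElem g x * (basisElem h y * basisElem l z)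
    rw [basisElem_mul, basisElem_mul]
    by_cases h1 : g = x * h * x⁻¹ <;> by_cases h2 : h = y * l * y⁻¹
    · simp [h1, h2, basisElem_mul, mul_assoc]
    · rw [if_pos h1, if_neg h2, basisElem_mul, if_neg]
      · simp [mul_def]
      · rintro rfl; apply h2
        have := congrArg (fun t => x⁻¹ * t * x) h1
        simpa [mul_assoc] using this.symm
    · rw [if_neg h1, if_pos h2, basisElem_mul, if_neg h1]
      simp [mul_def]
    · simp [h1, h2, mul_def]
  exact LinearMap.congr_fun (LinearMap.congr_fun (LinearMap.congr_fun this a) b) c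

variable [Fintype G]

instance : Ring (DrinfeldDouble k G) where
  __ := (inferInstance : AddCommGroup (DrinfeldDouble k G))
  left_distrib a b c := by simp [mul_def]
  right_distrib a b c := by simp [mul_def]
  zero_mul a := by simp [mul_def]
  mul_zero a := by simp [mul_def]
  mul_assoc := mul_assoc_aux
  one_mul a := by
    have : mulLin (1 : DrinfeldDouble k G) = LinearMap.id := by
      refine lhom_ext fun g x => ?_
      rw [one_def, map_sum, LinearMap.sum_apply, LinearMap.id_apply]
      simp [mulLin]
    exact LinearMap.congr_fun this a
  mul_one a := by
    have : mulLin.flip (1 : DrinfeldDouble k G) = LinearMap.id := by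
      refine lhom_ext fun g x => ?_
      rw [one_def, LinearMap.flip_apply, map_sum, LinearMap.id_apply]
      rw [Finset.sum_eq_single (x⁻¹ * g * x)]
      · simp [mulLin, mul_assoc]
      · intro b _ hb
        simp only [mulLin, lift_basisElem, ite_eq_right_iff]
        rintro rfl
        exact absurd (by simp [mul_assoc]) hb
      · simp
    exact LinearMap.congr_fun this a

instance : Algebra k (DrinfeldDouble k G) :=
  Algebra.ofModule (fun r x y => by simp [mul_def]) (fun r x y => by simp [mul_def])

/-- As a coalgebra, `D(G)` is `(k^G)^cop ⊗ kG`, with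
`Δ(e_g # h) = ∑_{a b = g} (e_b # h) ⊗ (e_a # h)` and `ε(e_g # h) = δ_{g, 1}`. -/
instance : CoalgebraStruct k (DrinfeldDouble k G) where
  comul := lift fun g h => ∑ b : G, basisElem b h ⊗ₜ[k] basisElem (g * b⁻¹) h
  counit := lift fun g _ => if g = 1 then 1 else 0

lemma comul_basisElem (g h : G) :
    Coalgebra.comul (R := k) (basisElem g h : DrinfeldDouble k G) =
      ∑ b : G, basisElem b h ⊗ₜ[k] basisElem (g * b⁻¹) h :=
  lift_basisElem _ g h

lemma counit_basisElem (g h : G) :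
    Coalgebra.counit (R := k) (basisElem g h : DrinfeldDouble k G) = if g = 1 then 1 else 0 :=
  lift_basisElem _ g h

instance : Coalgebra k (DrinfeldDouble k G) where
  coassoc := by
    refine lhom_ext fun g h => ?_
    simp only [LinearMap.coe_comp, LinearEquiv.coe_coe, Function.comp_apply, comul_basisElem,
      map_sum, LinearMap.rTensor_tmul, LinearMap.lTensor_tmul, TensorProduct.sum_tmul,
      TensorProduct.tmul_sum, TensorProduct.assoc_tmul]
    rw [Finset.sum_comm]
    refine Finset.sum_congr rfl fun b _ => ?_
    refine Fintype.sum_equiv (Equiv.mulRight b⁻¹) _ _ fun c => ?_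
    simp [mul_assoc]
  rTensor_counit_comp_comul := by
    refine lhom_ext fun g h => ?_
    simp [comul_basisElem, counit_basisElem, TensorProduct.ite_tmul]
  lTensor_counit_comp_comul := by
    refine lhom_ext fun g h => ?_
    simp [comul_basisElem, counit_basisElem, TensorProduct.tmul_ite, mul_inv_eq_one]

instance : Bialgebra k (DrinfeldDouble k G) where
  counit_one := by simp [one_def, counit_basisElem]
  comul_one := by
    simp only [one_def, map_sum, comul_basisElem, Algebra.TensorProduct.one_def,
      TensorProduct.sum_tmul, TensorProduct.tmul_sum]
    conv_rhs => rw [Finset.sum_comm]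
    rw [Finset.sum_comm]
    refine Finset.sum_congr rfl fun b _ => ?_
    exact Fintype.sum_equiv (Equiv.mulRight b⁻¹) _ _ fun c => by simp
  mul_compr₂_counit := by
    refine lhom_ext fun g x => lhom_ext fun h y => ?_
    simp only [LinearMap.compr₂_apply, LinearMap.mul_apply', basisElem_mul,
      LinearMap.compl₁₂_apply, counit_basisElem]
    by_cases hg : g = 1
    · subst hg
      by_cases hh : h = 1
      · subst hh; simp [counit_basisElem]
      · have : ¬ (1 = x * h * x⁻¹) := fun e => hh (by simpa using (conj_eq_one_iff.1 e.symm))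
        simp [this, hh]
    · split_ifs <;> simp_all [counit_basisElem]
  mul_compr₂_comul := by
    refine lhom_ext fun g x => lhom_ext fun h y => ?_
    simp only [LinearMap.compr₂_apply, LinearMap.mul_apply', basisElem_mul,
      LinearMap.compl₁₂_apply, comul_basisElem, Finset.sum_mul_sum,
      Algebra.TensorProduct.tmul_mul_tmul]
    rw [apply_ite Coalgebra.comul, comul_basisElem, map_zero]
    have key : ∀ b : G, ∑ c : G, (if b = x * c * x⁻¹ then basisElem b (x * y) else 0) ⊗ₜ[k]
        (if g * b⁻¹ = x * (h * c⁻¹) * x⁻¹ then basisElem (g * b⁻¹) (x * y) else 0) =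
        if g = x * h * x⁻¹ then (basisElem b (x * y) : DrinfeldDouble k G) ⊗ₜ[k]
          basisElem (g * b⁻¹) (x * y) else (0 : DrinfeldDouble k G ⊗[k] DrinfeldDouble k G) := by
      intro b
      rw [Finset.sum_eq_single (x⁻¹ * b * x)]
      · have e : g * b⁻¹ = x * (h * (x⁻¹ * b * x)⁻¹) * x⁻¹ ↔ g = x * h * x⁻¹ := by
          simp only [mul_inv_rev, inv_inv, mul_assoc, mul_inv_cancel, mul_one]
          simp only [← mul_assoc, mul_left_inj]
        have e0 : b = x * (x⁻¹ * b * x) * x⁻¹ := by simp [mul_assoc]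
        rw [if_pos e0]
        simp only [e]
        split_ifs
        · rfl
        · exact TensorProduct.tmul_zero _ _
      · intro c _ hc
        rw [if_neg, TensorProduct.zero_tmul]
        rintro rfl
        exact hc (by simp [mul_assoc])
      · simp
    simp only [key]
    split_ifs <;> simp

/-- The antipode: `S(e_g # h) = e_{h⁻¹ g⁻¹ h} # h⁻¹`. -/
instance : HopfAlgebra k (DrinfeldDouble k G) where
  antipode := lift fun g h => basisElem (h⁻¹ * g⁻¹ * h) h⁻¹
  mul_antipode_rTensor_comul := by
    refine lhom_ext fun g h => ?_
    simp only [LinearMap.coe_comp, Function.comp_apply, comul_basisElem, map_sum,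
      LinearMap.rTensor_tmul, LinearMap.mul'_apply, lift_basisElem, basisElem_mul,
      counit_basisElem, Algebra.linearMap_apply]
    have e : ∀ b : G, h⁻¹ * b⁻¹ * h = h⁻¹ * (g * b⁻¹) * h⁻¹⁻¹ ↔ g = 1 := fun b => by
      simp
    simp only [e, inv_mul_cancel]
    split_ifs
    · rw [map_one, one_def]
      exact Fintype.sum_equiv ((Equiv.inv G).trans (MulAut.conj h⁻¹).toEquiv) _ _
        fun b => by simp
    · simp
  mul_antipode_lTensor_comul := by
    refine lhom_ext fun g h => ?_
    simp only [LinearMap.coe_comp, Function.comp_apply, comul_basisElem, map_sum,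
      LinearMap.lTensor_tmul, LinearMap.mul'_apply, lift_basisElem, basisElem_mul,
      counit_basisElem, Algebra.linearMap_apply]
    have e : ∀ b : G, b = h * (h⁻¹ * (g * b⁻¹)⁻¹ * h) * h⁻¹ ↔ g = 1 := fun b => by
      simp [mul_assoc]
    simp only [e, mul_inv_cancel]
    split_ifs
    · rw [map_one, one_def]
    · simp

end Alg

section GroupLikes

variable {k G : Type*} [Field k] [Group G] [Fintype G]

/-- The element `χ # g = ∑ x, χ(x) e_x # g` for a linear character `χ` of `G` and `g ∈ G`. -/
def charElem (χ : G →* kˣ) (g : G) : DrinfeldDouble k G := ∑ x : G, (χ x : k) • basisElem x g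

variable [DecidableEq G]

lemma coef_charElem (χ : G →* kˣ) (g a b : G) :
    coef a b (charElem χ g) = if g = b then (χ a : k) else 0 := by
  simp only [charElem, map_sum, map_smul, coef_basisElem, ite_and, smul_eq_mul, mul_ite, mul_one,
    mul_zero, Finset.sum_ite_eq', Finset.mem_univ, if_true]

lemma isGroupLikeElem_charElem (χ : G →* kˣ) (g : G) : IsGroupLikeElem k (charElem χ g) where
  counit_eq_one := by simp [charElem, counit_basisElem]
  comul_eq_tmul_self := by
    simp only [charElem, map_sum, map_smul, comul_basisElem, TensorProduct.sum_tmul,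
      TensorProduct.tmul_sum, Finset.smul_sum]
    rw [Finset.sum_comm]
    conv_rhs => rw [Finset.sum_comm]
    refine Finset.sum_congr rfl fun b _ => ?_
    refine Fintype.sum_equiv (Equiv.mulRight b⁻¹) _ _ fun c => ?_
    rw [Equiv.coe_mulRight, TensorProduct.smul_tmul_smul]
    simp [← Units.val_mul]

lemma charElem_mul (χ χ' : G →* kˣ) (g g' : G) :
    charElem (χ * χ') (g * g') = (charElem χ g * charElem χ' g' : DrinfeldDouble k G) := by
  simp only [charElem, Finset.sum_mul_sum, smul_mul_smul_comm, basisElem_mul]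
  refine Finset.sum_congr rfl fun x _ => ?_
  rw [Finset.sum_eq_single (g⁻¹ * x * g)]
  · rw [if_pos (by simp [mul_assoc])]
    congr 1
    simp only [MonoidHom.mul_apply, Units.val_mul, map_mul, map_inv]
    rw [mul_right_comm, ← Units.val_mul (χ' g)⁻¹, inv_mul_cancel, Units.val_one, one_mul]
  · intro c _ hc
    rw [if_neg, smul_zero]
    rintro rfl
    exact hc (by simp [mul_assoc])
  · simp

lemma coef_comul (a b h h' : G) (x : DrinfeldDouble k G) :
    LinearMap.mul' k k (TensorProduct.map (coef b h) (coef a h') (Coalgebra.comul (R := k) x)) =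
      if h = h' then coef (a * b) h x else 0 := by
  have : LinearMap.mul' k k ∘ₗ TensorProduct.map (coef b h) (coef a h') ∘ₗ
      Coalgebra.comul (R := k) (A := DrinfeldDouble k G) =
      if h = h' then coef (a * b) h else 0 := by
    refine lhom_ext fun c d => ?_
    simp only [LinearMap.coe_comp, Function.comp_apply, comul_basisElem, map_sum,
      TensorProduct.map_tmul, LinearMap.mul'_apply, coef_basisElem]
    rw [Finset.sum_eq_single b]
    · by_cases h1 : h = h'
      · subst h1
        simp only [if_true, coef_basisElem, mul_inv_eq_iff_eq_mul]
        by_cases h2 : d = h <;> by_cases h3 : c = a * b <;> simp [h2, h3]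
      · by_cases h2 : d = h
        · subst h2; simp [h1]
        · simp [h1, h2]
    · intro e _ he
      simp [he]
    · simp
  have := LinearMap.congr_fun this x
  simp only [LinearMap.coe_comp, Function.comp_apply] at this
  rw [this]
  split_ifs <;> rfl

lemma coef_one_sum (x : DrinfeldDouble k G) :
    ∑ h : G, coef 1 h x = Coalgebra.counit (R := k) x := by
  have : ∑ h : G, coef 1 h = Coalgebra.counit (R := k) (A := DrinfeldDouble k G) := by
    refine lhom_ext fun c d => ?_
    simp only [LinearMap.sum_apply, coef_basisElem, counit_basisElem]
    by_cases h : c = 1 <;> simp [h]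
  rw [← this, LinearMap.sum_apply]

lemma exists_charElem_eq {x : DrinfeldDouble k G} (hx : IsGroupLikeElem k x) :
    ∃ (χ : G →* kˣ) (g : G), charElem χ g = x := by
  have hc : ∀ a b h h' : G, coef b h x * coef a h' x = if h = h' then coef (a * b) h x else 0 := by
    intro a b h h'
    have := coef_comul a b h h' x
    rwa [hx.comul_eq_tmul_self, TensorProduct.map_tmul, LinearMap.mul'_apply] at this
  have h1 : ∑ h : G, coef 1 h x = 1 := (coef_one_sum x).trans hx.counit_eq_one
  obtain ⟨g, -, hg⟩ : ∃ g ∈ Finset.univ, coef 1 g x ≠ 0 := by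
    by_contra! hcon
    rw [Finset.sum_eq_zero hcon] at h1
    exact zero_ne_one h1
  have hz : ∀ a h, h ≠ g → coef a h x = 0 := by
    intro a h hh
    have := hc a 1 g h
    rw [if_neg (Ne.symm hh)] at this
    exact (mul_eq_zero.1 this).resolve_left hg
  have hone : coef 1 g x = 1 := by
    rwa [Finset.sum_eq_single g (fun h _ hh => hz 1 h hh) (by simp)] at h1
  have hm : ∀ a b, coef (a * b) g x = coef a g x * coef b g x := fun a b => by
    have := hc a b g g
    rw [if_pos rfl] at this
    rw [← this, mul_comm]
  let f : G →* k := ⟨⟨fun a => coef a g x, hone⟩, hm⟩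
  refine ⟨f.toHomUnits, g, ext_coef fun a b => ?_⟩
  rw [coef_charElem]
  split_ifs with h
  · subst h; rfl
  · exact (hz a b (Ne.symm h)).symm

/-- The group-like element `χ # g`. -/
def toGroupLike (p : (G →* kˣ) × G) : GroupLike k (DrinfeldDouble k G) :=
  ⟨charElem p.1 p.2, isGroupLikeElem_charElem p.1 p.2⟩

lemma toGroupLike_injective : Function.Injective (toGroupLike (k := k) (G := G)) := by
  rintro ⟨χ, g⟩ ⟨χ', g'⟩ h
  have h0 : (charElem χ g : DrinfeldDouble k G) = charElem χ' g' := congrArg GroupLike.val h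
  have h1 : ∀ a b, coef a b (charElem χ g) = coef a b (charElem χ' g' : DrinfeldDouble k G) :=
    fun a b => by rw [h0]
  simp only [coef_charElem] at h1
  have hg : g' = g := by
    by_contra hne
    have := h1 1 g
    simp [hne] at this
  subst hg
  refine Prod.ext (MonoidHom.ext fun a => Units.ext ?_) rfl
  simpa using h1 a g'

lemma toGroupLike_surjective : Function.Surjective (toGroupLike (k := k) (G := G)) := by
  rintro ⟨x, hx⟩
  obtain ⟨χ, g, rfl⟩ := exists_charElem_eq hx
  exact ⟨(χ, g), rfl⟩

/-- The identification of `Γ = Ĝ × G` with the group of group-like elements of `D(G)`,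
`(χ, g) ↦ χ # g`. -/
def gammaEquiv : ((G →* kˣ) × G) ≃* GroupLike k (DrinfeldDouble k G) where
  __ := Equiv.ofBijective toGroupLike ⟨toGroupLike_injective, toGroupLike_surjective⟩
  map_mul' p q := GroupLike.val_injective (charElem_mul p.1 q.1 p.2 q.2)

end GroupLikes

section Automorphisms

variable (k G : Type*) [Field k] [Group G] [Fintype G] [DecidableEq G]

/-- Hopf algebra automorphisms of `D(G)` (a bialgebra morphism of Hopf algebras automatically
commutes with the antipodes). -/
abbrev HopfAut : Type _ := DrinfeldDouble k G ≃ₐc[k] DrinfeldDouble k G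

/-- The group `Aut(D(G))` under composition, `(φ * ψ)(x) = φ(ψ(x))`. -/
instance : Group (HopfAut k G) where
  mul φ ψ := ψ.trans φ
  one := BialgEquiv.refl k _
  inv φ := φ.symm
  mul_assoc _ _ _ := rfl
  one_mul _ := rfl
  mul_one _ := rfl
  inv_mul_cancel φ := DFunLike.ext _ _ fun x => φ.symm_apply_apply x

/-- The restriction of Hopf automorphisms to the group-like elements. -/
def restrictGroupLike : HopfAut k G →* MulAut (GroupLike k (DrinfeldDouble k G)) where
  toFun φ :=
    { toFun := fun x => ⟨φ x.val, x.isGroupLikeElem_val.map φ⟩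
      invFun := fun x => ⟨φ.symm x.val, x.isGroupLikeElem_val.map φ.symm⟩
      left_inv := fun x => GroupLike.val_injective (φ.symm_apply_apply x.val)
      right_inv := fun x => GroupLike.val_injective (φ.apply_symm_apply x.val)
      map_mul' := fun x y => GroupLike.val_injective (map_mul φ x.val y.val) }
  map_one' := rfl
  map_mul' _ _ := rfl

/-- The restriction map `Aut(D(G)) → Aut(Γ)`, where `Γ = Ĝ × G` is identified with the group of
group-like elements of `D(G)`. -/
def restriction : HopfAut k G →* MulAut ((G →* kˣ) × G) where
  toFun φ := (gammaEquiv.trans (restrictGroupLike k G φ)).trans gammaEquiv.symm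
  map_one' := by ext1 x; exact gammaEquiv.symm_apply_apply x
  map_mul' φ ψ := by
    ext1 x
    change gammaEquiv.symm _ = gammaEquiv.symm (restrictGroupLike k G φ
      (gammaEquiv (gammaEquiv.symm (restrictGroupLike k G ψ (gammaEquiv x)))))
    rw [MulEquiv.apply_symm_apply, map_mul]
    rfl

/-- `N`, the kernel of the restriction map. -/
def restrictionKer : Subgroup (HopfAut k G) := (restriction k G).ker

variable {k G}

/-- `id ⊗ ε : D(G) → k^G`. -/
def idTensorCounit : DrinfeldDouble k G →ₗ[k] (G → k) := lift fun g _ => Pi.single g 1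

/-- `ev_1 ⊗ id : D(G) → kG`. -/
def evalOneTensorId : DrinfeldDouble k G →ₗ[k] MonoidAlgebra k G :=
  lift fun g h => if g = 1 then MonoidAlgebra.of k G h else 0

/-- The components of an automorphism `ψ = (p, u, r, v)`:
`u(a) = (id ⊗ ε)(ψ(a # 1))` for `a ∈ k^G`. -/
def HopfAut.u (ψ : HopfAut k G) (a : G → k) : G → k :=
  idTensorCounit (ψ (∑ x : G, a x • basisElem x 1))

/-- `r(g) = (id ⊗ ε)(ψ(ε # g))` for `g ∈ G`. -/
def HopfAut.r (ψ : HopfAut k G) (g : G) : G → k := idTensorCounit (ψ (charElem 1 g))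

/-- `v(g) = (ev_1 ⊗ id)(ψ(ε # g))` for `g ∈ G`. -/
def HopfAut.v (ψ : HopfAut k G) (g : G) : MonoidAlgebra k G :=
  evalOneTensorId (ψ (charElem 1 g))

variable (k G)

/-- `Λ_c(G)`, the automorphisms of the form `(p, u, 1, id)`. -/
def LambdaC : Set (HopfAut k G) :=
  {ψ | (∀ g, ψ.r g = 1) ∧ ∀ g, ψ.v g = MonoidAlgebra.of k G g}

/-- `Λ(G)`, the automorphisms of the form `(p, id, 1, id)`. -/
def Lambda : Set (HopfAut k G) := {ψ ∈ LambdaC k G | ∀ a, ψ.u a = a}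

end Automorphisms

end DrinfeldDouble

section CentralAutomorphisms

variable (G : Type*) [Group G]

/-- The group `Aut_c(G)` of central automorphisms. -/
def centralAut : Subgroup (MulAut G) where
  carrier := {φ | ∀ g, φ g * g⁻¹ ∈ Subgroup.center G}
  one_mem' g := by simp
  mul_mem' {a b} ha hb g := by
    have := mul_mem (ha (b g)) (hb g)
    simpa [mul_assoc] using this
  inv_mem' {a} ha g := by
    have := inv_mem (ha (a⁻¹ g))
    simpa using this

/-- The subgroup `Aut_{c'}(G)` of `Aut_c(G)`. -/
def centralAutDerived : Subgroup (MulAut G) where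
  carrier := {φ | φ ∈ centralAut G ∧ ∀ g, φ g⁻¹ * g ∈ Subgroup.center G ⊓ commutator G}
  one_mem' := ⟨one_mem _, fun g => by simp⟩
  mul_mem' {a b} ha hb := ⟨mul_mem ha.1 hb.1, fun g => by
    have := mul_mem (ha.2 (b g)) (hb.2 g)
    simpa [mul_assoc] using this⟩
  inv_mem' {a} ha := ⟨inv_mem ha.1, fun g => by
    have := inv_mem (ha.2 (a⁻¹ g))
    simpa using this⟩

/-- `Hom(Z(G) ∩ G', Z(G))`. -/
abbrev CenterHom : Type _ :=
  ↥(Subgroup.center G ⊓ commutator G) →* ↥(Subgroup.center G)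

open scoped IsMulCommutative in
/-- `Hom(Z(G) ∩ G', Z(G))` is a group under pointwise multiplication. -/
instance : CommGroup (CenterHom G) := inferInstance

/-- The action of `Aut_{c'}(G)` on `Hom(Z(G) ∩ G', Z(G))`: `w` sends `f` to `f ∘ w⁻¹`. -/
def centralAutDerivedAction : centralAutDerived G →* MulAut (CenterHom G) where
  toFun w :=
    { toFun := fun f => f.comp
        (MulAut.characteristic (Subgroup.center G ⊓ commutator G) (w : MulAut G)⁻¹).toMonoidHom
      invFun := fun f => f.comp
        (MulAut.characteristic (Subgroup.center G ⊓ commutator G) (w : MulAut G)).toMonoidHom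
      left_inv := fun f => by ext x; simp
      right_inv := fun f => by ext x; simp
      map_mul' := fun _ _ => rfl }
  map_one' := by ext f x; simp
  map_mul' a b := by ext f x; simp

end CentralAutomorphisms

end

/-! An automorphism `ψ` fixing every `ε # h` is determined by the elements `ψ(e_a # 1)`, since `e_a
# h = (e_a # 1)(ε # h)`. Comultiplicativity rebuilds these from two components: `u`, seen through
`id ⊗ ε`, and `p`, seen through `ev_1 ⊗ id` (`coef_eq_sum_left`, `coef_eq_sum_right`).

The `p(e_c)` are orthogonal idempotents. Comparing the two reconstructions forces `c` to be central
when `p(e_c) ≠ 0`, and invariance under conjugation by `ε # g` puts `p(e_c)` in `kZ(G)`. Hence `id ⊗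
ε` is multiplicative on the `ψ(e_a # 1)`, and `u` is dual to a central automorphism `α` of `G`
(`exists_centralAut`). Composing `ψ` with the twist `e_g # h ↦ e_{α(g)} # h` makes `u` trivial.

What is left is `p`. If it is supported on a central subgroup `A`, its Fourier transform along a
chosen isomorphism of `A` with its dual is a family of group-likes of `kG`, that is, a homomorphism
`f : A → Z(G)` (`exists_shearHom_eq`). Conversely, translations by `A` decompose `D(G)` into
eigenspaces. These form an algebra grading by subcoalgebras, so multiplying degree `m` by the
central group-like `ε # f(m)` is a Hopf automorphism (`shearHom`).

Fixing all `χ # 1` as well says that `χ ∘ α = χ` and that every `χ` is trivial on the support of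
`p`. Characters detect `G'`, so `α ∈ Aut_{c'}(G)` and `A = Z(G) ∩ G'` suffices. Central
automorphisms fix `G'` pointwise, so twists and shears commute and the semidirect product is in fact
direct.

For the two consequences, the shear of an inclusion is nontrivial unless `Z(G) ∩ G' = 1`, and the
shear for `A = Z(G)`, `f = id` lies in `Λ_c(G)` but fixes all `χ # 1` only when `Z(G) ≤ G'`. -/

/-! ### Linear characters and self-duality of finite abelian groups -/

section Characters

variable (k : Type*) [Field k] [IsAlgClosed k] [CharZero k]

/-- Linear characters separate the elements of a finite group modulo its derived subgroup. -/
lemma mem_commutator_of_forall_char {G : Type*} [Group G] [Finite G] {g : G}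
    (h : ∀ χ : G →* kˣ, χ g = 1) : g ∈ commutator G := by
  by_contra hg
  have h1 : Abelianization.of g ≠ 1 := fun h1 => hg (by
    rw [← Abelianization.ker_of]; exact h1)
  obtain ⟨φ, hφ⟩ := CommGroup.exists_apply_ne_one_of_hasEnoughRootsOfUnity (Abelianization G) k h1
  exact hφ (h (φ.comp Abelianization.of))

lemma char_eq_one_of_mem_commutator {k : Type*} [Field k] {G : Type*} [Group G] {g : G}
    (hg : g ∈ commutator G) (χ : G →* kˣ) : χ g = 1 :=
  Abelianization.commutator_subset_ker χ hg

/-- A perfect pairing of a group with itself, that is an identification with its dual. -/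
structure DualPairing (k A : Type*) [Field k] [Group A] where
  /-- The identification of the group with its group of characters. -/
  toHom : A →* A →* kˣ
  bijective : Function.Bijective toHom
  separating : ∀ c, (∀ m, toHom m c = 1) → c = 1

lemma nonempty_dualPairing (A : Type*) [Group A] [Finite A] (hA : ∀ a b : A, a * b = b * a) :
    Nonempty (DualPairing k A) := by
  let _ : CommGroup A := { (inferInstance : Group A) with mul_comm := hA }
  obtain ⟨e⟩ := CommGroup.monoidHom_mulEquiv_of_hasEnoughRootsOfUnity A k
  refine ⟨⟨e.symm.toMonoidHom, e.symm.bijective, fun c hc => ?_⟩⟩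
  by_contra h
  obtain ⟨φ, hφ⟩ := CommGroup.exists_apply_ne_one_of_hasEnoughRootsOfUnity A k h
  refine hφ ?_
  simpa using hc (e φ)

end Characters

namespace DualPairing

variable {k A : Type*} [Field k] [Group A] [Fintype A]

/-- Character orthogonality: shifting the variable by `d` multiplies the sum by a value different
from `1`. Injectivity of `toHom` supplies `d` here; `separating` does so in `sum_left`. -/
lemma sum_right [DecidableEq A] (β : DualPairing k A) (m : A) :
    ∑ c, (β.toHom m c : k) = if m = 1 then (Fintype.card A : k) else 0 := by
  split_ifs with h
  · subst h; simp
  · obtain ⟨d, hd⟩ : ∃ d, β.toHom m d ≠ 1 := by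
      by_contra! hc
      exact h (β.bijective.1 ((MonoidHom.ext hc).trans β.toHom.map_one.symm))
    have h1 : ∑ c, (β.toHom m c : k) = (β.toHom m d : k) * ∑ c, (β.toHom m c : k) := by
      rw [Finset.mul_sum]
      refine (Fintype.sum_equiv (Equiv.mulLeft d) _ _ fun c => ?_).symm
      simp
    have h2 : ((β.toHom m d : k) - 1) * ∑ c, (β.toHom m c : k) = 0 := by
      rw [sub_mul, one_mul, ← h1, sub_self]
    refine (mul_eq_zero.1 h2).resolve_left fun h3 => hd (Units.ext ?_)
    simpa [sub_eq_zero] using h3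

lemma sum_left [DecidableEq A] (β : DualPairing k A) (c : A) :
    ∑ m, (β.toHom m c : k) = if c = 1 then (Fintype.card A : k) else 0 := by
  split_ifs with h
  · subst h; simp
  · obtain ⟨d, hd⟩ : ∃ d, β.toHom d c ≠ 1 := by
      by_contra! hc
      exact h (β.separating c hc)
    have h1 : ∑ m, (β.toHom m c : k) = (β.toHom d c : k) * ∑ m, (β.toHom m c : k) := by
      rw [Finset.mul_sum]
      refine (Fintype.sum_equiv (Equiv.mulLeft d) _ _ fun m => ?_).symm
      simp
    have h2 : ((β.toHom d c : k) - 1) * ∑ m, (β.toHom m c : k) = 0 := by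
      rw [sub_mul, one_mul, ← h1, sub_self]
    refine (mul_eq_zero.1 h2).resolve_left fun h3 => hd (Units.ext ?_)
    simpa [sub_eq_zero] using h3

end DualPairing

/-- Write `w x = z * x` with `z` central; `z` cancels in the conjugation. This is what makes the
twist multiplicative although it leaves the second leg unchanged. -/
lemma centralAut_conj {G : Type*} [Group G] {w : MulAut G} (hw : w ∈ centralAut G) (x h : G) :
    w (x * h * x⁻¹) = x * w h * x⁻¹ := by
  obtain ⟨z, hz⟩ : ∃ z, z = w x * x⁻¹ := ⟨_, rfl⟩
  have hc := Subgroup.mem_center_iff.1 (hz ▸ hw x)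
  have e : w x = z * x := by simp [hz]
  rw [map_mul, map_mul, map_inv, e, mul_assoc z, ← hc, mul_inv_rev]
  simp only [mul_assoc]
  rw [← mul_assoc z, ← hc]
  simp [mul_assoc]

namespace DrinfeldDouble

/-! ### The group-likes `ε # g` -/

section CharElem

variable {k G : Type*} [Field k] [Group G] [Fintype G] [DecidableEq G]

lemma basisElem_mul_charElem_one (a h g : G) :
    (basisElem a h * charElem 1 g : DrinfeldDouble k G) = basisElem a (h * g) := by
  simp only [charElem, MonoidHom.one_apply, Units.val_one, one_smul, Finset.mul_sum, basisElem_mul]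
  rw [Finset.sum_eq_single (h⁻¹ * a * h)]
  · rw [if_pos (by simp [mul_assoc])]
  · intro c _ hc
    rw [if_neg]
    rintro rfl
    exact hc (by simp [mul_assoc])
  · simp

lemma charElem_one_mul_basisElem (a h g : G) :
    (charElem 1 g * basisElem a h : DrinfeldDouble k G) = basisElem (g * a * g⁻¹) (g * h) := by
  simp only [charElem, MonoidHom.one_apply, Units.val_one, one_smul, Finset.sum_mul, basisElem_mul]
  rw [Finset.sum_eq_single (g * a * g⁻¹)]
  · rw [if_pos rfl]
  · intro c _ hc
    rw [if_neg hc]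
  · simp

lemma charElem_one_one : (charElem 1 1 : DrinfeldDouble k G) = 1 := by
  simp [charElem, one_def]

lemma charElem_one_comm {g : G} (hg : g ∈ Subgroup.center G) (x : DrinfeldDouble k G) :
    charElem 1 g * x = x * charElem 1 g := by
  have : LinearMap.mulLeft k (charElem 1 g : DrinfeldDouble k G) =
      LinearMap.mulRight k (charElem 1 g) := by
    refine lhom_ext fun a h => ?_
    simp only [LinearMap.mulLeft_apply, LinearMap.mulRight_apply, basisElem_mul_charElem_one,
      charElem_one_mul_basisElem]
    rw [← Subgroup.mem_center_iff.1 hg a, ← Subgroup.mem_center_iff.1 hg h]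
    simp
  exact LinearMap.congr_fun this x

lemma counit_mul_charElem_one (x : DrinfeldDouble k G) (g : G) :
    Coalgebra.counit (R := k) (x * charElem 1 g) = Coalgebra.counit (R := k) x := by
  rw [Bialgebra.counit_mul, (isGroupLikeElem_charElem 1 g).counit_eq_one, mul_one]

lemma comul_mul_charElem_one (x : DrinfeldDouble k G) (g : G) :
    Coalgebra.comul (R := k) (x * charElem 1 g) =
      TensorProduct.map (LinearMap.mulRight k (charElem 1 g)) (LinearMap.mulRight k (charElem 1 g))
        (Coalgebra.comul (R := k) x) := by
  rw [Bialgebra.comul_mul, (isGroupLikeElem_charElem 1 g).comul_eq_tmul_self]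
  generalize (Coalgebra.comul (R := k) x) = t
  induction t with
  | zero => simp
  | tmul a b => simp
  | add a b ha hb => rw [add_mul, ha, hb, map_add]

lemma charElem_one_mul (g g' : G) :
    (charElem 1 (g * g') : DrinfeldDouble k G) = charElem 1 g * charElem 1 g' := by
  have h : (1 : G →* kˣ) * 1 = 1 := MonoidHom.ext fun x => mul_one 1
  rw [← charElem_mul, h]

lemma charElem_eq_mul (χ : G →* kˣ) (g : G) :
    (charElem χ g : DrinfeldDouble k G) = charElem χ 1 * charElem 1 g := by
  have h : χ * 1 = χ := MonoidHom.ext fun x => mul_one (χ x)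
  rw [← charElem_mul, one_mul, h]

end CharElem

/-! ### Hopf automorphisms from central automorphisms of `G` -/

section Twist

variable {k G : Type*} [Field k] [Group G] [Fintype G] [DecidableEq G]

/-- The linear map `e_g # h ↦ e_{w(g)} # h`. -/
noncomputable def twist (w : MulAut G) : DrinfeldDouble k G →ₗ[k] DrinfeldDouble k G :=
  lift fun g h => basisElem (w g) h

@[simp] lemma twist_basisElem (w : MulAut G) (g h : G) :
    twist w (basisElem g h : DrinfeldDouble k G) = basisElem (w g) h :=
  lift_basisElem _ g h

/-- The automorphism `e_g # h ↦ e_{w(g)} # h` as a morphism of bialgebras. -/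
noncomputable def twistBialgHom (w : centralAut G) :
    DrinfeldDouble k G →ₐc[k] DrinfeldDouble k G where
  __ := twist (w : MulAut G)
  counit_comp := by
    refine lhom_ext fun g h => ?_
    simp [counit_basisElem]
  map_comp_comul := by
    refine lhom_ext fun g h => ?_
    simp only [LinearMap.coe_comp, Function.comp_apply, comul_basisElem, map_sum,
      TensorProduct.map_tmul, twist_basisElem]
    refine Fintype.sum_equiv (w : MulAut G).toEquiv _ _ fun c => ?_
    simp
  map_one' := by
    change twist (w : MulAut G) 1 = 1
    simp only [one_def, map_sum, twist_basisElem]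
    exact Fintype.sum_equiv (w : MulAut G).toEquiv _ _ fun c => rfl
  map_mul' x y := by
    change twist (w : MulAut G) (x * y) = twist (w : MulAut G) x * twist (w : MulAut G) y
    have : (LinearMap.mul k (DrinfeldDouble k G)).compr₂ (twist (w : MulAut G)) =
        (LinearMap.mul k (DrinfeldDouble k G)).compl₁₂ (twist (w : MulAut G))
          (twist (w : MulAut G)) := by
      refine lhom_ext fun g x => lhom_ext fun h y => ?_
      simp only [LinearMap.compr₂_apply, LinearMap.mul_apply', basisElem_mul,
        LinearMap.compl₁₂_apply, twist_basisElem, apply_ite (twist (w : MulAut G)), map_zero]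
      rw [← centralAut_conj w.2]
      simp only [EmbeddingLike.apply_eq_iff_eq]
    exact LinearMap.congr_fun (LinearMap.congr_fun this x) y

lemma twist_mul (w w' : MulAut G) (x : DrinfeldDouble k G) :
    twist (w * w') x = twist w (twist w' x) := by
  have : twist (k := k) (w * w') = twist w ∘ₗ twist w' := lhom_ext fun g h => by simp
  exact LinearMap.congr_fun this x

lemma twist_one (x : DrinfeldDouble k G) : twist 1 x = x := by
  have : twist (k := k) (1 : MulAut G) = LinearMap.id := lhom_ext fun g h => by simp
  exact LinearMap.congr_fun this x

/-- The embedding of the group of central automorphisms of `G` into `Aut(D(G))`. -/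
noncomputable def twistHom : centralAut G →* HopfAut k G where
  toFun w := BialgEquiv.ofBialgHom (twistBialgHom w) (twistBialgHom w⁻¹)
    (DFunLike.ext _ _ fun x => by
      change twist (w : MulAut G) (twist ((w⁻¹ : centralAut G) : MulAut G) x) = x
      rw [← twist_mul, Subgroup.coe_inv, mul_inv_cancel, twist_one])
    (DFunLike.ext _ _ fun x => by
      change twist ((w⁻¹ : centralAut G) : MulAut G) (twist (w : MulAut G) x) = x
      rw [← twist_mul, Subgroup.coe_inv, inv_mul_cancel, twist_one])
  map_one' := DFunLike.ext _ _ fun x => twist_one x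
  map_mul' w w' := DFunLike.ext _ _ fun x => by
    change twist ((w * w' : centralAut G) : MulAut G) x =
      twist (w : MulAut G) (twist (w' : MulAut G) x)
    rw [← twist_mul, Subgroup.coe_mul]

lemma twistHom_apply (w : centralAut G) (x : DrinfeldDouble k G) :
    twistHom w x = twist (w : MulAut G) x := rfl

lemma twist_charElem (w : MulAut G) (χ : G →* kˣ) (g : G) :
    twist w (charElem χ g : DrinfeldDouble k G) =
      charElem (χ.comp (w⁻¹ : MulAut G).toMonoidHom) g := by
  simp only [charElem, map_sum, map_smul, twist_basisElem]
  refine Fintype.sum_equiv w.toEquiv _ _ fun c => ?_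
  simp

end Twist

/-! ### Translations of the first leg -/

section Translate

variable {k G : Type*} [Field k] [Group G] [Fintype G] [DecidableEq G]

/-- The linear map `e_g # h ↦ e_{gc} # h`. -/
noncomputable def translate (c : G) : DrinfeldDouble k G →ₗ[k] DrinfeldDouble k G :=
  lift fun g h => basisElem (g * c) h

@[simp] lemma translate_basisElem (c g h : G) :
    translate c (basisElem g h : DrinfeldDouble k G) = basisElem (g * c) h :=
  lift_basisElem _ g h

lemma translate_translate (c d : G) (x : DrinfeldDouble k G) :
    translate c (translate d x) = translate (d * c) x := by
  have : translate (k := k) c ∘ₗ translate d = translate (d * c) :=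
    lhom_ext fun g h => by simp [mul_assoc]
  exact LinearMap.congr_fun this x

lemma translate_one (x : DrinfeldDouble k G) : translate 1 x = x := by
  have : translate (k := k) (1 : G) = LinearMap.id := lhom_ext fun g h => by simp
  exact LinearMap.congr_fun this x

lemma translate_charElem (c : G) (χ : G →* kˣ) (g : G) :
    translate c (charElem χ g : DrinfeldDouble k G) =
      (((χ c)⁻¹ : kˣ) : k) • charElem χ g := by
  simp only [charElem, map_sum, map_smul, translate_basisElem, Finset.smul_sum, smul_smul]
  refine Fintype.sum_equiv (Equiv.mulRight c) _ _ fun d => ?_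
  rw [Equiv.coe_mulRight, ← Units.val_mul, map_mul, mul_comm (χ d), inv_mul_cancel_left]

lemma translate_mul {c : G} (hc : c ∈ Subgroup.center G) (x y : DrinfeldDouble k G) :
    translate c (x * y) = translate c x * translate c y := by
  have : (LinearMap.mul k (DrinfeldDouble k G)).compr₂ (translate c) =
      (LinearMap.mul k (DrinfeldDouble k G)).compl₁₂ (translate c) (translate c) := by
    refine lhom_ext fun g x => lhom_ext fun h y => ?_
    simp only [LinearMap.compr₂_apply, LinearMap.mul_apply', basisElem_mul,
      LinearMap.compl₁₂_apply, translate_basisElem, apply_ite (translate c), map_zero]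
    have : x * (h * c) * x⁻¹ = x * h * x⁻¹ * c := by
      simp only [mul_assoc]
      rw [Subgroup.mem_center_iff.1 hc x⁻¹]
    rw [this]
    simp only [mul_left_inj]
  exact LinearMap.congr_fun (LinearMap.congr_fun this x) y

/-- A translation can be absorbed by either tensor factor of `Δ`; only the right-hand version needs
`c` central. Together they make the eigenspaces subcoalgebras. -/
lemma comul_translate_left (c : G) (x : DrinfeldDouble k G) :
    Coalgebra.comul (R := k) (translate c x) =
      TensorProduct.map (translate c) LinearMap.id (Coalgebra.comul (R := k) x) := by
  have : Coalgebra.comul (R := k) (A := DrinfeldDouble k G) ∘ₗ translate c =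
      TensorProduct.map (translate c) LinearMap.id ∘ₗ Coalgebra.comul (R := k) := by
    refine lhom_ext fun g h => ?_
    simp only [LinearMap.coe_comp, Function.comp_apply, translate_basisElem, comul_basisElem,
      map_sum, TensorProduct.map_tmul, LinearMap.id_apply]
    refine Fintype.sum_equiv (Equiv.mulRight c⁻¹) _ _ fun d => ?_
    simp [mul_assoc]
  exact LinearMap.congr_fun this x

lemma comul_translate_right (c : G) (x : DrinfeldDouble k G) (hc : c ∈ Subgroup.center G) :
    Coalgebra.comul (R := k) (translate c x) =
      TensorProduct.map LinearMap.id (translate c) (Coalgebra.comul (R := k) x) := by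
  have : Coalgebra.comul (R := k) (A := DrinfeldDouble k G) ∘ₗ translate c =
      TensorProduct.map LinearMap.id (translate c) ∘ₗ Coalgebra.comul (R := k) := by
    refine lhom_ext fun g h => ?_
    simp only [LinearMap.coe_comp, Function.comp_apply, translate_basisElem, comul_basisElem,
      map_sum, TensorProduct.map_tmul, LinearMap.id_apply]
    refine Finset.sum_congr rfl fun d _ => ?_
    have := Subgroup.mem_center_iff.1 hc d⁻¹
    simp [mul_assoc, this]
  exact LinearMap.congr_fun this x

end Translate

/-! ### The grading by a central subgroup and the shear automorphisms -/

section Grading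

variable {k G : Type*} [Field k] [Group G] [Fintype G] [DecidableEq G]
  {A : Subgroup G}

/-- Eigenvectors for the translations by the elements of `A`; these are the homogeneous elements
of a grading of `D(G)` by `A` when `A` is central. -/
def IsHomogeneous (β : DualPairing k A) (m : A) (x : DrinfeldDouble k G) : Prop :=
  ∀ c : A, translate (c : G) x = (((β.toHom m c)⁻¹ : kˣ) : k) • x

lemma IsHomogeneous.mul (hA : A ≤ Subgroup.center G) {β : DualPairing k A} {m m' : A}
    {x y : DrinfeldDouble k G} (hx : IsHomogeneous β m x) (hy : IsHomogeneous β m' y) :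
    IsHomogeneous β (m * m') (x * y) := by
  intro c
  rw [translate_mul (hA c.2), hx c, hy c, smul_mul_smul_comm, ← Units.val_mul, map_mul,
    MonoidHom.mul_apply, mul_inv]

lemma isHomogeneous_charElem {β : DualPairing k A} {m : A} {χ : G →* kˣ} (g : G)
    (h : ∀ c : A, β.toHom m c = χ c) : IsHomogeneous β m (charElem χ g) := by
  intro c
  rw [translate_charElem, h]

lemma isHomogeneous_charElem_one (β : DualPairing k A) (g : G) :
    IsHomogeneous β 1 (charElem 1 g) :=
  isHomogeneous_charElem g fun c => by simp

lemma IsHomogeneous.mul_charElem_one (hA : A ≤ Subgroup.center G) {β : DualPairing k A} {m : A}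
    {x : DrinfeldDouble k G} (hx : IsHomogeneous β m x) (g : G) :
    IsHomogeneous β m (x * charElem 1 g) := by
  simpa using hx.mul hA (isHomogeneous_charElem_one β g)

variable [Fintype A]

/-- The projection of `D(G)` to the homogeneous elements of degree `m`. -/
noncomputable def proj (β : DualPairing k A) (m : A) :
    DrinfeldDouble k G →ₗ[k] DrinfeldDouble k G :=
  (Fintype.card A : k)⁻¹ • ∑ c : A, (β.toHom m c : k) • translate (c : G)

lemma proj_apply (β : DualPairing k A) (m : A) (x : DrinfeldDouble k G) :
    proj β m x = (Fintype.card A : k)⁻¹ • ∑ c : A, (β.toHom m c : k) • translate (c : G) x := by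
  simp [proj]

lemma isHomogeneous_proj (β : DualPairing k A) (m : A) (x : DrinfeldDouble k G) :
    IsHomogeneous β m (proj β m x) := by
  intro d
  rw [proj_apply, map_smul, smul_comm, map_sum,
    Finset.smul_sum (s := Finset.univ) (r := (((β.toHom m d)⁻¹ : kˣ) : k))]
  congr 1
  refine Fintype.sum_equiv (Equiv.mulRight d) _ _ fun c => ?_
  rw [map_smul, translate_translate, smul_smul, Equiv.coe_mulRight, ← Units.val_mul, map_mul,
    mul_comm (β.toHom m c), inv_mul_cancel_left]
  rfl

lemma comul_proj_left (β : DualPairing k A) (m : A) (x : DrinfeldDouble k G) :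
    Coalgebra.comul (R := k) (proj β m x) =
      TensorProduct.map (proj β m) LinearMap.id (Coalgebra.comul (R := k) x) := by
  have : TensorProduct.map (proj β m) (LinearMap.id (R := k) (M := DrinfeldDouble k G)) =
      (Fintype.card A : k)⁻¹ • ∑ c : A, (β.toHom m c : k) •
        TensorProduct.map (translate (c : G)) LinearMap.id := by
    ext a b
    simp [proj, TensorProduct.sum_tmul, ← TensorProduct.smul_tmul']
  rw [this, proj_apply]
  simp only [map_smul, map_sum, LinearMap.smul_apply, LinearMap.sum_apply, comul_translate_left]

lemma comul_proj_right (hA : A ≤ Subgroup.center G) (β : DualPairing k A) (m : A)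
    (x : DrinfeldDouble k G) :
    Coalgebra.comul (R := k) (proj β m x) =
      TensorProduct.map LinearMap.id (proj β m) (Coalgebra.comul (R := k) x) := by
  have : TensorProduct.map (LinearMap.id (R := k) (M := DrinfeldDouble k G)) (proj β m) =
      (Fintype.card A : k)⁻¹ • ∑ c : A, (β.toHom m c : k) •
        TensorProduct.map LinearMap.id (translate (c : G)) := by
    ext a b
    simp [proj, TensorProduct.tmul_sum, TensorProduct.smul_tmul']
  rw [this, proj_apply]
  simp only [map_smul, map_sum, LinearMap.smul_apply, LinearMap.sum_apply]
  exact congrArg _ (Finset.sum_congr rfl fun c _ => by rw [comul_translate_right _ _ (hA c.2)])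

/-- The linear map multiplying homogeneous elements of degree `m` by `ε # f(m)`. -/
noncomputable def shear (β : DualPairing k A) (f : A →* Subgroup.center G) :
    DrinfeldDouble k G →ₗ[k] DrinfeldDouble k G :=
  ∑ m : A, LinearMap.mulRight k (charElem 1 (f m : G)) ∘ₗ proj β m

lemma shear_apply (β : DualPairing k A) (f : A →* Subgroup.center G) (x : DrinfeldDouble k G) :
    shear β f x = ∑ m : A, proj β m x * charElem 1 (f m : G) := by
  simp [shear]

lemma card_ne_zero (k : Type*) [Field k] [CharZero k] (A : Type*) [Group A] [Fintype A] :
    (Fintype.card A : k) ≠ 0 :=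
  Nat.cast_ne_zero.2 Fintype.card_ne_zero

variable [CharZero k]

lemma sum_proj (β : DualPairing k A) (x : DrinfeldDouble k G) : ∑ m, proj β m x = x := by
  simp only [proj_apply]
  rw [← Finset.smul_sum, Finset.sum_comm]
  simp only [← Finset.sum_smul, β.sum_left, ite_smul, zero_smul, Finset.sum_ite_eq',
    Finset.mem_univ, if_true, OneMemClass.coe_one, translate_one]
  rw [smul_smul, inv_mul_cancel₀ (card_ne_zero k A), one_smul]

/-- On degree `m` the translation eigenvalues turn the projector into the average of the character
of index `m' * m⁻¹`, so orthogonality applies. -/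
lemma proj_of_isHomogeneous {β : DualPairing k A} {m : A} {x : DrinfeldDouble k G}
    (hx : IsHomogeneous β m x) (m' : A) : proj β m' x = if m' = m then x else 0 := by
  have h : ∀ c : A, (β.toHom m' c : k) • translate (c : G) x =
      (β.toHom (m' * m⁻¹) c : k) • x := fun c => by
    rw [hx c, smul_smul, ← Units.val_mul, map_mul, map_inv, MonoidHom.mul_apply,
      MonoidHom.inv_apply]
  rw [proj_apply]
  simp only [h, ← Finset.sum_smul, β.sum_right, mul_inv_eq_one]
  split_ifs with h
  · rw [smul_smul, inv_mul_cancel₀ (card_ne_zero k A), one_smul]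
  · simp

lemma hom_ext_proj {M : Type*} [AddCommGroup M] [Module k M] (β : DualPairing k A)
    {f f' : DrinfeldDouble k G →ₗ[k] M} (h : ∀ m x, IsHomogeneous β m x → f x = f' x) :
    f = f' := by
  ext x
  rw [← sum_proj β x, map_sum, map_sum]
  exact Finset.sum_congr rfl fun m _ => h m _ (isHomogeneous_proj β m x)

/-- Since `proj β m` fixes `x` and passes through `Δ` on each side, applying it twice shows `Δ x ∈
D_m ⊗ D_m`: homogeneous components are subcoalgebras. -/
lemma comul_eq_of_isHomogeneous (hA : A ≤ Subgroup.center G) {β : DualPairing k A} {m : A}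
    {x : DrinfeldDouble k G} (hx : IsHomogeneous β m x) :
    Coalgebra.comul (R := k) x =
      TensorProduct.map (proj β m) (proj β m) (Coalgebra.comul (R := k) x) := by
  have h : proj β m x = x := by rw [proj_of_isHomogeneous hx, if_pos rfl]
  conv_lhs => rw [← h, comul_proj_left]
  conv_lhs => rw [← h, comul_proj_right hA]
  rw [← LinearMap.comp_apply, ← TensorProduct.map_comp, LinearMap.comp_id, LinearMap.id_comp]

lemma shear_of_isHomogeneous {β : DualPairing k A} (f : A →* Subgroup.center G) {m : A}
    {x : DrinfeldDouble k G} (hx : IsHomogeneous β m x) :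
    shear β f x = x * charElem 1 (f m : G) := by
  simp [shear_apply, proj_of_isHomogeneous hx]

lemma shear_charElem_one (β : DualPairing k A) (f : A →* Subgroup.center G) (g : G) :
    shear β f (charElem 1 g) = charElem 1 g := by
  rw [shear_of_isHomogeneous f (isHomogeneous_charElem_one β g), map_one, OneMemClass.coe_one,
    charElem_one_one, mul_one]

/-- The map `shear` as a morphism of bialgebras. -/
noncomputable def shearBialgHom (hA : A ≤ Subgroup.center G) (β : DualPairing k A)
    (f : A →* Subgroup.center G) : DrinfeldDouble k G →ₐc[k] DrinfeldDouble k G where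
  __ := shear β f
  counit_comp := by
    refine hom_ext_proj β fun m x hx => ?_
    change Coalgebra.counit (R := k) (shear β f x) = _
    rw [shear_of_isHomogeneous f hx, counit_mul_charElem_one]
  map_comp_comul := by
    refine hom_ext_proj β fun m x hx => ?_
    change TensorProduct.map (shear β f) (shear β f) (Coalgebra.comul (R := k) x) =
      Coalgebra.comul (R := k) (shear β f x)
    -- Both legs of `Δ x` have degree `m`, so both shears multiply by the same group-like.
    have h : shear β f ∘ₗ proj β m = LinearMap.mulRight k (charElem 1 (f m : G)) ∘ₗ proj β m :=
      LinearMap.ext fun y => shear_of_isHomogeneous f (isHomogeneous_proj β m y)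
    rw [shear_of_isHomogeneous f hx, comul_mul_charElem_one, comul_eq_of_isHomogeneous hA hx,
      ← LinearMap.comp_apply (TensorProduct.map _ _) (TensorProduct.map _ _),
      ← LinearMap.comp_apply (TensorProduct.map _ _) (TensorProduct.map _ _),
      ← TensorProduct.map_comp, ← TensorProduct.map_comp, h]
  map_one' := by
    change shear β f 1 = 1
    rw [← charElem_one_one, shear_charElem_one]
  map_mul' x y := by
    change shear β f (x * y) = shear β f x * shear β f y
    have : (LinearMap.mul k (DrinfeldDouble k G)).compr₂ (shear β f) =
        (LinearMap.mul k (DrinfeldDouble k G)).compl₁₂ (shear β f) (shear β f) := by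
      refine hom_ext_proj β fun m x hx => hom_ext_proj β fun m' y hy => ?_
      simp only [LinearMap.compr₂_apply, LinearMap.mul_apply', LinearMap.compl₁₂_apply]
      rw [shear_of_isHomogeneous f hx, shear_of_isHomogeneous f hy,
        shear_of_isHomogeneous f (hx.mul hA hy), map_mul, Subgroup.coe_mul, charElem_one_mul, mul_assoc x y,
        mul_assoc x (charElem 1 (f m : G)), ← mul_assoc (charElem 1 (f m : G)) y,
        charElem_one_comm (f m).2 y, mul_assoc y]
    exact LinearMap.congr_fun (LinearMap.congr_fun this x) y

open scoped IsMulCommutative in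
lemma shear_mul (hA : A ≤ Subgroup.center G) (β : DualPairing k A)
    (f f' : A →* Subgroup.center G) (x : DrinfeldDouble k G) :
    shear β (f * f') x = shear β f (shear β f' x) := by
  have : shear β (f * f') = shear β f ∘ₗ shear β f' := by
    refine hom_ext_proj β fun m x hx => ?_
    rw [LinearMap.comp_apply, shear_of_isHomogeneous _ hx, shear_of_isHomogeneous _ hx,
      shear_of_isHomogeneous f (hx.mul_charElem_one hA _), MonoidHom.mul_apply, Subgroup.coe_mul,
      charElem_one_mul, mul_assoc, charElem_one_comm (f m).2]
  exact LinearMap.congr_fun this x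

open scoped IsMulCommutative in
lemma shear_one (β : DualPairing k A) (x : DrinfeldDouble k G) :
    shear β (1 : A →* Subgroup.center G) x = x := by
  simp [shear_apply, charElem_one_one, sum_proj]

open scoped IsMulCommutative in
/-- The embedding of `Hom(A, Z(G))` into `Aut(D(G))`, for a central subgroup `A`. -/
noncomputable def shearHom (hA : A ≤ Subgroup.center G) (β : DualPairing k A) :
    (A →* Subgroup.center G) →* HopfAut k G where
  toFun f := BialgEquiv.ofBialgHom (shearBialgHom hA β f) (shearBialgHom hA β f⁻¹)
    (DFunLike.ext _ _ fun x => by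
      change shear β f (shear β f⁻¹ x) = x
      rw [← shear_mul hA, mul_inv_cancel, shear_one])
    (DFunLike.ext _ _ fun x => by
      change shear β f⁻¹ (shear β f x) = x
      rw [← shear_mul hA, inv_mul_cancel, shear_one])
  map_one' := DFunLike.ext _ _ fun x => shear_one β x
  map_mul' f f' := DFunLike.ext _ _ fun x => by
    change shear β (f * f') x = shear β f (shear β f' x)
    rw [← shear_mul hA]

lemma shearHom_apply (hA : A ≤ Subgroup.center G) (β : DualPairing k A)
    (f : A →* Subgroup.center G) (x : DrinfeldDouble k G) : shearHom hA β f x = shear β f x := rfl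

end Grading

end DrinfeldDouble

/-- A function with values in a field that is idempotent in the sense of a group-like element of a
group algebra is the indicator function of a point. -/
lemma exists_eq_ite_of_mul_eq_ite {k X : Type*} [Field k] [Fintype X] [DecidableEq X] (q : X → k)
    (hmul : ∀ a b, q a * q b = if a = b then q a else 0) (hsum : ∑ a, q a = 1) :
    ∃ x, ∀ a, q a = if a = x then 1 else 0 := by
  obtain ⟨x, -, hx⟩ : ∃ x ∈ Finset.univ, q x ≠ 0 := by
    by_contra! hc
    rw [Finset.sum_eq_zero hc] at hsum
    exact zero_ne_one hsum
  refine ⟨x, fun a => ?_⟩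
  split_ifs with h
  · subst h
    have := hmul a a
    rw [if_pos rfl] at this
    exact mul_left_cancel₀ hx (by rw [this, mul_one])
  · have := hmul a x
    rw [if_neg h] at this
    exact (mul_eq_zero.1 this).resolve_right hx

namespace DrinfeldDouble

/-! ### The components of an automorphism -/

section Components

variable {k G : Type*} [Field k] [Group G] [Fintype G] [DecidableEq G]

lemma sum_coef_smul_basisElem (x : DrinfeldDouble k G) :
    ∑ g, ∑ h, coef g h x • basisElem g h = x := by
  refine ext_coef fun a b => ?_
  simp only [map_sum, map_smul, coef_basisElem, smul_eq_mul, mul_ite, mul_one, mul_zero, ite_and]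
  rw [Finset.sum_eq_single a]
  · simp
  · intro c _ hc
    simp [hc]
  · simp

lemma idTensorCounit_basisElem (g h : G) :
    idTensorCounit (basisElem g h : DrinfeldDouble k G) = Pi.single g 1 :=
  lift_basisElem _ g h

lemma evalOneTensorId_basisElem (g h : G) :
    evalOneTensorId (basisElem g h : DrinfeldDouble k G) =
      if g = 1 then MonoidAlgebra.of k G h else 0 :=
  lift_basisElem _ g h

lemma idTensorCounit_apply (x : DrinfeldDouble k G) (g : G) :
    idTensorCounit x g = ∑ h, coef g h x := by
  have : LinearMap.proj g ∘ₗ idTensorCounit (k := k) (G := G) = ∑ h, coef g h := by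
    refine lhom_ext fun a b => ?_
    simp [idTensorCounit_basisElem, coef_basisElem, Pi.single_apply, ite_and, eq_comm]
  simpa using LinearMap.congr_fun this x

lemma evalOneTensorId_apply (x : DrinfeldDouble k G) (h : G) :
    (evalOneTensorId x).coeff h = coef 1 h x := by
  have : Finsupp.lapply h ∘ₗ (MonoidAlgebra.coeffLinearEquiv k).toLinearMap ∘ₗ
      evalOneTensorId (k := k) (G := G) = coef 1 h := by
    refine lhom_ext fun a b => ?_
    rw [coef_basisElem, LinearMap.comp_apply, LinearMap.comp_apply, evalOneTensorId_basisElem]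
    by_cases ha : a = 1
    · simp only [ha, if_true, true_and]
      exact Finsupp.single_apply
    · simp [ha]
  exact LinearMap.congr_fun this x

lemma idTensorCounit_mul_charElem_one (x : DrinfeldDouble k G) (g : G) :
    idTensorCounit (x * charElem 1 g) = idTensorCounit x := by
  have : idTensorCounit ∘ₗ LinearMap.mulRight k (charElem 1 g : DrinfeldDouble k G) =
      idTensorCounit := by
    refine lhom_ext fun a b => ?_
    simp [basisElem_mul_charElem_one, idTensorCounit_basisElem]
  exact LinearMap.congr_fun this x

lemma idTensorCounit_charElem (χ : G →* kˣ) (g : G) :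
    idTensorCounit (charElem χ g : DrinfeldDouble k G) = fun x => (χ x : k) := by
  ext x
  simp [idTensorCounit_apply, coef_charElem]

lemma evalOneTensorId_charElem (χ : G →* kˣ) (g : G) :
    evalOneTensorId (charElem χ g : DrinfeldDouble k G) = MonoidAlgebra.of k G g := by
  simp [charElem, evalOneTensorId_basisElem]

lemma evalOneTensorId_mul (x y : DrinfeldDouble k G) :
    evalOneTensorId (x * y) = evalOneTensorId x * evalOneTensorId y := by
  have : (LinearMap.mul k (DrinfeldDouble k G)).compr₂ evalOneTensorId =
      (LinearMap.mul k (MonoidAlgebra k G)).compl₁₂ evalOneTensorId evalOneTensorId := by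
    refine lhom_ext fun g x => lhom_ext fun h y => ?_
    simp only [LinearMap.compr₂_apply, LinearMap.mul_apply', basisElem_mul,
      LinearMap.compl₁₂_apply, evalOneTensorId_basisElem]
    by_cases hg : g = 1
    · subst hg
      by_cases hh : h = 1
      · subst hh; simp [evalOneTensorId_basisElem]
      · have : ¬ (1 = x * h * x⁻¹) := fun e => hh (conj_eq_one_iff.1 e.symm)
        simp [this, hh]
    · split_ifs <;> simp_all [evalOneTensorId_basisElem]
  exact LinearMap.congr_fun (LinearMap.congr_fun this x) y

lemma coef_conj (g y h : G) (x : DrinfeldDouble k G) :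
    coef (g * y * g⁻¹) (g * h * g⁻¹) (charElem 1 g * x * charElem 1 g⁻¹) = coef y h x := by
  have : coef (g * y * g⁻¹) (g * h * g⁻¹) ∘ₗ LinearMap.mulRight k (charElem 1 g⁻¹) ∘ₗ
      LinearMap.mulLeft k (charElem 1 g : DrinfeldDouble k G) = coef y h := by
    refine lhom_ext fun a b => ?_
    simp [charElem_one_mul_basisElem, basisElem_mul_charElem_one, coef_basisElem]
  exact LinearMap.congr_fun this x

lemma idTensorCounit_basisElem_mul {z : G} (hz : z ∈ Subgroup.center G) (g : G)
    (y : DrinfeldDouble k G) :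
    idTensorCounit (basisElem g z * y) = Pi.single g 1 * idTensorCounit y := by
  have : idTensorCounit ∘ₗ LinearMap.mulLeft k (basisElem g z : DrinfeldDouble k G) =
      LinearMap.mulLeft k (Pi.single g 1) ∘ₗ idTensorCounit := by
    refine lhom_ext fun a b => ?_
    have h : z * a * z⁻¹ = a := by rw [← Subgroup.mem_center_iff.1 hz a]; simp
    simp only [LinearMap.comp_apply, LinearMap.mulLeft_apply, basisElem_mul, h,
      idTensorCounit_basisElem]
    split_ifs with h'
    · subst h'
      rw [idTensorCounit_basisElem, ← Pi.single_mul, one_mul]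
    · rw [map_zero]
      ext x
      by_cases hx : x = g
      · subst hx; simp [h']
      · simp [hx]
  exact LinearMap.congr_fun this y

/-- In general `id ⊗ ε` is not multiplicative, because `G` acts on `k^G` by conjugation; central
second legs act trivially. -/
lemma idTensorCounit_mul_of_central {x : DrinfeldDouble k G}
    (hx : ∀ g h, coef g h x ≠ 0 → h ∈ Subgroup.center G) (y : DrinfeldDouble k G) :
    idTensorCounit (x * y) = idTensorCounit x * idTensorCounit y := by
  conv_lhs => rw [← sum_coef_smul_basisElem x]
  conv_rhs => rw [← sum_coef_smul_basisElem x]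
  simp only [Finset.sum_mul, map_sum, smul_mul_assoc, map_smul]
  refine Finset.sum_congr rfl fun g _ => Finset.sum_congr rfl fun h _ => ?_
  by_cases h0 : coef g h x = 0
  · simp [h0]
  · rw [idTensorCounit_basisElem_mul (hx g h h0), idTensorCounit_basisElem]

lemma basisElem_eq_mul (g h : G) :
    (basisElem g h : DrinfeldDouble k G) = basisElem g 1 * charElem 1 h := by
  rw [basisElem_mul_charElem_one, one_mul]

lemma basisElem_one_mul (g h : G) : (basisElem g 1 * basisElem h 1 : DrinfeldDouble k G) =
    if g = h then basisElem g 1 else 0 := by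
  simp [basisElem_mul]

/-- The image of `ε # g` is group-like, hence some `χ # h`; `r` reads off `χ` and `v` reads off `h`.
-/
lemma mem_LambdaC_iff {ψ : HopfAut k G} :
    ψ ∈ LambdaC k G ↔ ∀ g, ψ (charElem 1 g) = charElem 1 g := by
  constructor
  · rintro ⟨hr, hv⟩ g
    obtain ⟨χ, h, e⟩ := exists_charElem_eq ((isGroupLikeElem_charElem (k := k) 1 g).map ψ)
    have hr := hr g
    have hv := hv g
    rw [HopfAut.r, ← e, idTensorCounit_charElem] at hr
    rw [HopfAut.v, ← e, evalOneTensorId_charElem] at hv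
    have h1 : χ = 1 := MonoidHom.ext fun x => Units.ext (congrFun hr x)
    rw [← e, h1, MonoidAlgebra.of_injective hv]
  · intro h
    refine ⟨fun g => ?_, fun g => ?_⟩
    · rw [HopfAut.r, h, idTensorCounit_charElem]
      rfl
    · rw [HopfAut.v, h, evalOneTensorId_charElem]

lemma mem_restrictionKer_iff {ψ : HopfAut k G} :
    ψ ∈ restrictionKer k G ↔ ∀ χ g, ψ (charElem χ g) = charElem χ g := by
  rw [restrictionKer, MonoidHom.mem_ker]
  constructor
  · intro h χ g
    have h1 : gammaEquiv.symm (restrictGroupLike k G ψ (gammaEquiv (χ, g))) = (χ, g) :=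
      congrArg (fun φ : MulAut ((G →* kˣ) × G) => φ (χ, g)) h
    rw [MulEquiv.symm_apply_eq] at h1
    exact congrArg GroupLike.val h1
  · intro h
    refine MulEquiv.ext fun p => ?_
    change gammaEquiv.symm (restrictGroupLike k G ψ (gammaEquiv p)) = p
    rw [MulEquiv.symm_apply_eq]
    exact GroupLike.val_injective (h p.1 p.2)

lemma mem_restrictionKer_iff' {ψ : HopfAut k G} :
    ψ ∈ restrictionKer k G ↔ ψ ∈ LambdaC k G ∧ ∀ χ, ψ (charElem χ 1) = charElem χ 1 := by
  rw [mem_restrictionKer_iff, mem_LambdaC_iff]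
  refine ⟨fun h => ⟨h 1, fun χ => h χ 1⟩, fun h χ g => ?_⟩
  rw [charElem_eq_mul, map_mul, h.1, h.2]

end Components

/-! ### Structure of `Λ_c(G)` -/

section Structure

variable {k G : Type*} [Field k] [Group G] [Fintype G] [DecidableEq G]

/-- Comultiplicativity of `ψ` in coordinates. The later identities for `u` and `p` come from summing
over `h` or `h'`, or from setting `x` or `y` to `1`. -/
lemma sum_coef_mul_coef (ψ : HopfAut k G) (a x y h h' : G) :
    ∑ b, coef y h (ψ (basisElem b 1)) * coef x h' (ψ (basisElem (a * b⁻¹) 1)) =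
      if h = h' then coef (x * y) h (ψ (basisElem a 1)) else 0 := by
  rw [← coef_comul x y h h', ← CoalgHomClass.map_comp_comul_apply ψ, comul_basisElem]
  simp

lemma idTensorCounit_surjective :
    Function.Surjective (idTensorCounit : DrinfeldDouble k G →ₗ[k] (G → k)) := by
  intro v
  refine ⟨∑ g, v g • basisElem g 1, ?_⟩
  simp only [map_sum, map_smul, idTensorCounit_basisElem]
  ext x
  simp [Pi.single_apply]

lemma u_idTensorCounit {ψ : HopfAut k G} (hψ : ψ ∈ LambdaC k G) (x : DrinfeldDouble k G) :
    ψ.u (idTensorCounit x) = idTensorCounit (ψ x) := by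
  have hψ := mem_LambdaC_iff.1 hψ
  have : idTensorCounit ∘ₗ (ψ : DrinfeldDouble k G →ₗ[k] DrinfeldDouble k G) ∘ₗ
      Fintype.linearCombination k (fun g : G => (basisElem g 1 : DrinfeldDouble k G)) ∘ₗ
        idTensorCounit =
      idTensorCounit ∘ₗ (ψ : DrinfeldDouble k G →ₗ[k] DrinfeldDouble k G) := by
    refine lhom_ext fun a b => ?_
    have e := basisElem_eq_mul (k := k) a b
    simp only [LinearMap.comp_apply, idTensorCounit_basisElem,
      Fintype.linearCombination_apply_single, one_smul]
    change idTensorCounit (ψ _) = idTensorCounit (ψ _)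
    rw [e, map_mul, hψ, idTensorCounit_mul_charElem_one]
  exact LinearMap.congr_fun this x

/-- Both `ψ` and `id ⊗ ε` are onto, so `u` is a surjective endomorphism of a finite-dimensional
space. -/
lemma u_injective {ψ : HopfAut k G} (hψ : ψ ∈ LambdaC k G) : Function.Injective ψ.u := by
  let u : (G → k) →ₗ[k] (G → k) :=
    idTensorCounit ∘ₗ (ψ : DrinfeldDouble k G →ₗ[k] DrinfeldDouble k G) ∘ₗ
      Fintype.linearCombination k (fun g : G => (basisElem g 1 : DrinfeldDouble k G))
  have hu : ∀ x, u (idTensorCounit x) = idTensorCounit (ψ x) := u_idTensorCounit hψ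
  refine (LinearMap.injective_iff_surjective (f := u)).2 fun v => ?_
  obtain ⟨x, rfl⟩ := idTensorCounit_surjective v
  exact ⟨idTensorCounit (ψ.symm x), by rw [hu]; congr 1; exact ψ.apply_symm_apply x⟩

lemma idTensorCounit_injective_of_mem_LambdaC {ψ : HopfAut k G} (hψ : ψ ∈ LambdaC k G) {a b : G}
    (h : idTensorCounit (ψ (basisElem a 1)) = idTensorCounit (ψ (basisElem b 1))) : a = b := by
  rw [← u_idTensorCounit hψ, ← u_idTensorCounit hψ, idTensorCounit_basisElem,
    idTensorCounit_basisElem] at h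
  by_contra hab
  have := congrFun (u_injective hψ h) a
  simp [hab] at this

lemma idTensorCounit_ne_zero_of_mem_LambdaC {ψ : HopfAut k G} (hψ : ψ ∈ LambdaC k G) (a : G) :
    idTensorCounit (ψ (basisElem a 1)) ≠ 0 := by
  intro h
  have h0 : ψ.u 0 = 0 := by
    simpa using u_idTensorCounit hψ 0
  rw [← u_idTensorCounit hψ, idTensorCounit_basisElem, ← h0] at h
  have := congrFun (u_injective hψ h) a
  simp at this

/-- As `ev_1 ⊗ id` is multiplicative, the component `p` sends the orthogonal idempotents `e_a` to
orthogonal idempotents of `kG`. -/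
lemma evalOneTensorId_mul_self_eq (ψ : HopfAut k G) (a b : G) :
    evalOneTensorId (ψ (basisElem a 1)) * evalOneTensorId (ψ (basisElem b 1)) =
      if a = b then evalOneTensorId (ψ (basisElem a 1)) else 0 := by
  rw [← evalOneTensorId_mul, ← map_mul, basisElem_one_mul]
  split_ifs <;> simp

/-- Reconstruction of `ψ(e_a # 1)` from `u` and `p`. `coef_eq_sum_right` exchanges the two legs, and
comparing both versions yields centrality. -/
lemma coef_eq_sum_left (ψ : HopfAut k G) (a y h : G) :
    ∑ b, idTensorCounit (ψ (basisElem b 1)) y * coef 1 h (ψ (basisElem (a * b⁻¹) 1)) =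
      coef y h (ψ (basisElem a 1)) := by
  simp only [idTensorCounit_apply, Finset.sum_mul]
  rw [Finset.sum_comm]
  simp [sum_coef_mul_coef]

lemma coef_eq_sum_right (ψ : HopfAut k G) (a y h : G) :
    ∑ b, idTensorCounit (ψ (basisElem (a * b⁻¹) 1)) y * coef 1 h (ψ (basisElem b 1)) =
      coef y h (ψ (basisElem a 1)) := by
  simp only [idTensorCounit_apply, Finset.sum_mul]
  rw [Finset.sum_comm]
  simp_rw [mul_comm _ (coef 1 h _)]
  simp [sum_coef_mul_coef]

/-- Multiplying the two reconstructions by the idempotent `p(e_c)` isolates one term on each side,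
giving `u(e_{c⁻¹a}) = u(e_{ac⁻¹})`; injectivity of `u` then makes `c⁻¹` commute with every `a`. -/
lemma mem_center_of_evalOneTensorId_ne_zero {ψ : HopfAut k G} (hψ : ψ ∈ LambdaC k G) {c : G}
    (hc : evalOneTensorId (ψ (basisElem c 1)) ≠ 0) : c ∈ Subgroup.center G := by
  have key : ∀ a y, idTensorCounit (ψ (basisElem (c⁻¹ * a) 1)) y =
      idTensorCounit (ψ (basisElem (a * c⁻¹) 1)) y := by
    intro a y
    have h1 : ∑ b, idTensorCounit (ψ (basisElem b 1)) y •
          evalOneTensorId (ψ (basisElem (a * b⁻¹) 1)) =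
        ∑ b, idTensorCounit (ψ (basisElem (a * b⁻¹) 1)) y •
          evalOneTensorId (ψ (basisElem b 1)) := by
      ext h
      have := (coef_eq_sum_left ψ a y h).trans (coef_eq_sum_right ψ a y h).symm
      simpa [evalOneTensorId_apply] using this
    have h2 := congrArg (· * evalOneTensorId (ψ (basisElem c 1))) h1
    simp only [Finset.sum_mul, smul_mul_assoc, evalOneTensorId_mul_self_eq] at h2
    rw [Finset.sum_eq_single (c⁻¹ * a), Finset.sum_eq_single c] at h2
    · simp only [mul_inv_rev, inv_inv, mul_inv_cancel_left, if_true] at h2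
      exact smul_left_injective k hc h2
    · intro b _ hb
      rw [if_neg hb, smul_zero]
    · simp
    · intro b _ hb
      rw [if_neg, smul_zero]
      rintro rfl
      exact hb (by simp)
    · simp
  have h3 : ∀ a, c⁻¹ * a = a * c⁻¹ := fun a =>
    idTensorCounit_injective_of_mem_LambdaC hψ (funext (key a))
  exact inv_mem_iff.1 (Subgroup.mem_center_iff.2 fun a => (h3 a).symm)

/-- Each `ε # g` is fixed by `ψ`, so `ψ` commutes with conjugation by it. -/
lemma coef_conj_of_mem_LambdaC {ψ : HopfAut k G} (hψ : ψ ∈ LambdaC k G) (g a y h : G) :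
    coef (g * y * g⁻¹) (g * h * g⁻¹) (ψ (basisElem (g * a * g⁻¹) 1)) =
      coef y h (ψ (basisElem a 1)) := by
  have hψ := mem_LambdaC_iff.1 hψ
  have e : (basisElem (g * a * g⁻¹) 1 : DrinfeldDouble k G) =
      charElem 1 g * basisElem a 1 * charElem 1 g⁻¹ := by
    rw [charElem_one_mul_basisElem, basisElem_mul_charElem_one]
    simp
  rw [e, map_mul ψ, map_mul ψ, hψ, hψ, coef_conj]

lemma mem_center_of_coef_one_ne_zero {ψ : HopfAut k G} (hψ : ψ ∈ LambdaC k G) {c h : G}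
    (hc : coef 1 h (ψ (basisElem c 1)) ≠ 0) : c ∈ Subgroup.center G := by
  refine mem_center_of_evalOneTensorId_ne_zero hψ fun h0 => hc ?_
  rw [← evalOneTensorId_apply, h0]
  simp

lemma mem_center_of_coef_one_ne_zero' {ψ : HopfAut k G} (hψ : ψ ∈ LambdaC k G) {c h : G}
    (hc : coef 1 h (ψ (basisElem c 1)) ≠ 0) : h ∈ Subgroup.center G := by
  have hconj : ∀ g a, coef 1 (g * h * g⁻¹) (ψ (basisElem a 1)) = coef 1 h (ψ (basisElem a 1)) := by
    intro g a
    by_cases ha : a ∈ Subgroup.center G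
    · have := coef_conj_of_mem_LambdaC hψ g a 1 h
      rwa [Subgroup.mem_center_iff.1 ha, mul_one, mul_inv_cancel, mul_inv_cancel_right] at this
    · rw [not_not.1 (mt (mem_center_of_coef_one_ne_zero hψ) ha),
        not_not.1 (mt (mem_center_of_coef_one_ne_zero hψ) ha)]
  refine Subgroup.mem_center_iff.2 fun g => ?_
  by_contra hg
  -- The sum vanishes because `h` and its conjugate differ, but conjugation invariance turns it into
  -- the sum for the pair `(h, h)`, which is the coefficient assumed nonzero.
  have h1 := sum_coef_mul_coef ψ c 1 1 h (g * h * g⁻¹)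
  simp only [hconj, sum_coef_mul_coef, if_true] at h1
  rw [if_neg (fun e => hg (eq_mul_inv_iff_mul_eq.1 e).symm), mul_one] at h1
  exact hc h1

lemma mem_center_of_coef_ne_zero {ψ : HopfAut k G} (hψ : ψ ∈ LambdaC k G) {c y h : G}
    (hc : coef y h (ψ (basisElem c 1)) ≠ 0) : h ∈ Subgroup.center G := by
  rw [← coef_eq_sum_left] at hc
  obtain ⟨b, -, hb⟩ := Finset.exists_ne_zero_of_sum_ne_zero hc
  exact mem_center_of_coef_one_ne_zero' hψ (right_ne_zero_of_mul hb)

lemma sum_idTensorCounit_mul (ψ : HopfAut k G) (a x y : G) :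
    ∑ b, idTensorCounit (ψ (basisElem b 1)) y * idTensorCounit (ψ (basisElem (a * b⁻¹) 1)) x =
      idTensorCounit (ψ (basisElem a 1)) (x * y) := by
  simp only [idTensorCounit_apply, Finset.sum_mul_sum]
  rw [Finset.sum_comm]
  refine Finset.sum_congr rfl fun h _ => ?_
  rw [Finset.sum_comm]
  simp [sum_coef_mul_coef]

/-- The component `u` of an automorphism in `Λ_c(G)` is given by a central automorphism of `G`. -/
theorem exists_centralAut {ψ : HopfAut k G} (hψ : ψ ∈ LambdaC k G) :
    ∃ α : MulAut G, α ∈ centralAut G ∧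
      ∀ a y, idTensorCounit (ψ (basisElem a 1)) y = if a = α y then 1 else 0 := by
  have h1 : ∀ y, ∃ x, ∀ a, idTensorCounit (ψ (basisElem a 1)) y = if a = x then 1 else 0 := by
    intro y
    refine exists_eq_ite_of_mul_eq_ite _ (fun a b => ?_) ?_
    -- Centrality of the second legs makes `id ⊗ ε` multiplicative here, so orthogonality of the
    -- `e_a` passes to `u(e_a)`.
    · have h := idTensorCounit_mul_of_central (fun g h => mem_center_of_coef_ne_zero hψ)
        (ψ (basisElem b 1)) (x := ψ (basisElem a 1))
      rw [← map_mul, basisElem_one_mul] at h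
      rw [← Pi.mul_apply, ← h]
      split_ifs <;> simp
    · rw [← Finset.sum_apply, ← map_sum, ← map_sum, ← one_def, map_one, ← charElem_one_one,
        idTensorCounit_charElem]
      simp
  choose α hα using h1
  have hmul : ∀ x y, α (x * y) = α x * α y := by
    intro x y
    -- At `a = α (x * y)` the right side is `1`, so the only possible term, `b = α y`, must satisfy
    -- `a * b⁻¹ = α x`.
    have h2 := sum_idTensorCounit_mul ψ (α (x * y)) x y
    simp only [hα, if_true] at h2
    simp only [ite_mul, one_mul, zero_mul, Finset.sum_ite_eq', Finset.mem_univ, if_true,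
      ite_eq_left_iff, zero_ne_one, imp_false, not_not] at h2
    exact (mul_inv_eq_iff_eq_mul.1 h2)
  have hsurj : Function.Surjective α := by
    intro a
    by_contra! ha
    refine idTensorCounit_ne_zero_of_mem_LambdaC hψ a (funext fun y => ?_)
    rw [hα, if_neg (Ne.symm (ha y)), Pi.zero_apply]
  let A : G →* G := MonoidHom.mk' α hmul
  let e : MulAut G := MulEquiv.ofBijective A (Finite.surjective_iff_bijective.1 hsurj)
  refine ⟨e, fun g => Subgroup.mem_center_iff.2 fun t => ?_, fun a y => hα y a⟩
  -- As `α` is also multiplicative and onto, `g` and `α g` induce the same conjugation, so they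
  -- differ by a central element.
  have hconj : ∀ y, α (g * y * g⁻¹) = g * α y * g⁻¹ := by
    intro y
    have h3 : idTensorCounit (ψ (basisElem (g * α y * g⁻¹) 1)) (g * y * g⁻¹) = 1 := by
      rw [idTensorCounit_apply, ← Fintype.sum_equiv (MulAut.conj g).toEquiv
        (fun h => coef y h (ψ (basisElem (α y) 1))) _
        fun h => (coef_conj_of_mem_LambdaC hψ g (α y) y h).symm, ← idTensorCounit_apply, hα,
        if_pos rfl]
    rw [hα] at h3
    by_contra hne
    rw [if_neg (Ne.symm hne)] at h3
    exact zero_ne_one h3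
  obtain ⟨y, hy⟩ := hsurj (g⁻¹ * t * g)
  have h4 := hconj y
  have hinv : α g⁻¹ = (α g)⁻¹ := map_inv A g
  rw [hmul, hmul, hy, hinv] at h4
  change t * (α g * g⁻¹) = α g * g⁻¹ * t
  have h5 : α g * g⁻¹ * t = t * (α g * g⁻¹) := by
    have := congrArg (fun x => x * α g * g⁻¹) h4
    simpa [mul_assoc] using this
  exact h5.symm

/-- An automorphism in `Λ_c(G)` is determined by its components `u` and `p`. -/
lemma coef_eq_of_idTensorCounit_eq {ψ : HopfAut k G} {α : MulAut G}
    (hα : ∀ a y, idTensorCounit (ψ (basisElem a 1)) y = if a = α y then 1 else 0) (a y h : G) :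
    coef y h (ψ (basisElem a 1)) = coef 1 h (ψ (basisElem (a * (α y)⁻¹) 1)) := by
  rw [← coef_eq_sum_left]
  simp [hα]

end Structure

end DrinfeldDouble

/-- The central factors by which `w` changes `x` and `y` cancel in their commutator. -/
lemma centralAut_apply_of_mem_commutator {G : Type*} [Group G] {w : MulAut G}
    (hw : w ∈ centralAut G) {g : G} (hg : g ∈ commutator G) : w g = g := by
  have h : commutator G ≤ MonoidHom.eqLocus w.toMonoidHom (MonoidHom.id G) := by
    rw [commutator_def, Subgroup.commutator_le]
    intro x _ y _
    rw [commutatorElement_def]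
    change w (x * y * x⁻¹ * y⁻¹) = x * y * x⁻¹ * y⁻¹
    obtain ⟨z, hz⟩ : ∃ z, z = w y * y⁻¹ := ⟨_, rfl⟩
    have hc := Subgroup.mem_center_iff.1 (hz ▸ hw y)
    have e : w y = z * y := by simp [hz]
    rw [map_mul, centralAut_conj hw, map_inv, e, mul_inv_rev,
      ← mul_assoc x z, hc]
    have h1 : z * x * y * x⁻¹ * (y⁻¹ * z⁻¹) = z * (x * y * x⁻¹ * y⁻¹) * z⁻¹ := by
      simp only [mul_assoc]
    rw [h1, ← hc, mul_inv_cancel_right]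
  exact h hg

/-- The action is trivial because its arguments lie in `G'`, which central automorphisms fix
pointwise. -/
lemma centralAutDerivedAction_apply {G : Type*} [Group G] (w : centralAutDerived G)
    (f : CenterHom G) : centralAutDerivedAction G w f = f := by
  refine MonoidHom.ext fun x => ?_
  change f _ = f x
  congr 1
  exact Subtype.ext
    (centralAut_apply_of_mem_commutator (inv_mem w.2.1 : (w : MulAut G)⁻¹ ∈ _) x.2.2)

namespace DrinfeldDouble

/-! ### Interaction of shears with twists, components and group-likes -/

section Shear

variable {k G : Type*} [Field k] [Group G] [Fintype G] [DecidableEq G]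
  {A : Subgroup G}

lemma twistHom_mem_restrictionKer {w : centralAut G} (hw : (w : MulAut G) ∈ centralAutDerived G) :
    twistHom w ∈ restrictionKer k G := by
  refine mem_restrictionKer_iff.2 fun χ g => ?_
  rw [twistHom_apply, twist_charElem]
  congr 1
  refine MonoidHom.ext fun x => ?_
  have h := char_eq_one_of_mem_commutator ((inv_mem hw).2 x⁻¹).2 χ
  rw [inv_inv, map_mul, map_inv, mul_inv_eq_one] at h
  exact h

variable [Fintype A]

lemma twist_shear {w : MulAut G} (hw : ∀ c : A, w c = c) (β : DualPairing k A)
    (f : A →* Subgroup.center G) (x : DrinfeldDouble k G) :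
    twist w (shear β f x) = shear β f (twist w x) := by
  have h1 : ∀ (c : A) (x : DrinfeldDouble k G),
      twist w (translate (c : G) x) = translate (c : G) (twist w x) := fun c x => by
    have : twist (k := k) w ∘ₗ translate (c : G) = translate (c : G) ∘ₗ twist w :=
      lhom_ext fun a b => by simp [hw]
    exact LinearMap.congr_fun this x
  have h2 : ∀ (g : G) (x : DrinfeldDouble k G),
      twist w (x * charElem 1 g) = twist w x * charElem 1 g := fun g x => by
    have : twist (k := k) w ∘ₗ LinearMap.mulRight k (charElem 1 g) =
        LinearMap.mulRight k (charElem 1 g) ∘ₗ twist w :=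
      lhom_ext fun a b => by simp [basisElem_mul_charElem_one]
    exact LinearMap.congr_fun this x
  simp only [shear_apply, map_sum, h2, proj_apply, map_smul, h1]

lemma coef_proj_mul_charElem_one (β : DualPairing k A) (m : A) (a g y h : G) :
    coef y h (proj β m (basisElem a 1) * charElem 1 g) =
      (Fintype.card A : k)⁻¹ *
        ∑ c : A, (β.toHom m c : k) * if a * c = y ∧ g = h then 1 else 0 := by
  simp only [proj_apply, smul_mul_assoc, Finset.sum_mul, translate_basisElem,
    basisElem_mul_charElem_one, one_mul, map_smul, map_sum, coef_basisElem, smul_eq_mul]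

variable [CharZero k]

/-- Shears change only second legs, so they are invisible to `id ⊗ ε`. This separates the two
factors of the semidirect product. -/
lemma idTensorCounit_shear (β : DualPairing k A) (f : A →* Subgroup.center G)
    (x : DrinfeldDouble k G) : idTensorCounit (shear β f x) = idTensorCounit x := by
  rw [shear_apply, map_sum]
  simp only [idTensorCounit_mul_charElem_one]
  rw [← map_sum, sum_proj]

lemma apply_eq_one_of_shear_eq {β : DualPairing k A} {f : A →* Subgroup.center G}
    (hf : ∀ x, shear β f x = x) (m : A) : f m = 1 := by
  -- The component of `e_1 # 1` of degree `m` has coefficient `1/|A|` at `(1, 1)`; multiplying by `ε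
  -- # f(m)` moves it away unless `f m = 1`.
  have h := hf (proj β m (basisElem 1 1))
  rw [shear_of_isHomogeneous f (isHomogeneous_proj β m _)] at h
  have h1 := congrArg (coef 1 1) h
  rw [← mul_one (proj β m (basisElem 1 1)), ← charElem_one_one, mul_assoc, charElem_one_one,
    one_mul, ← charElem_one_one, coef_proj_mul_charElem_one, coef_proj_mul_charElem_one] at h1
  by_contra hne
  have hne' : (f m : G) ≠ 1 := fun e => hne (Subtype.ext e)
  simp [hne'] at h1
  exact card_ne_zero k A h1.symm

open scoped IsMulCommutative in
lemma shearHom_injective (hA : A ≤ Subgroup.center G) (β : DualPairing k A) :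
    Function.Injective (shearHom hA β) := by
  refine (injective_iff_map_eq_one _).2 fun f hf => MonoidHom.ext fun m => ?_
  exact apply_eq_one_of_shear_eq (β := β) (fun x => by rw [← shearHom_apply hA, hf]; rfl) m

lemma shearHom_mem_LambdaC (hA : A ≤ Subgroup.center G) (β : DualPairing k A)
    (f : A →* Subgroup.center G) : shearHom hA β f ∈ LambdaC k G :=
  mem_LambdaC_iff.2 fun g => shear_charElem_one β f g

/-- The degree of `χ # 1` is given by the restriction of `χ` to `A`, which is trivial when `A ≤ G'`.
-/
lemma shearHom_mem_restrictionKer (hA : A ≤ Subgroup.center G) (hA' : A ≤ commutator G)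
    (β : DualPairing k A) (f : A →* Subgroup.center G) :
    shearHom hA β f ∈ restrictionKer k G := by
  refine mem_restrictionKer_iff'.2 ⟨shearHom_mem_LambdaC hA β f, fun χ => ?_⟩
  have h : IsHomogeneous β 1 (charElem χ 1) := isHomogeneous_charElem 1 fun c => by
    rw [char_eq_one_of_mem_commutator (hA' c.2), map_one, MonoidHom.one_apply]
  rw [shearHom_apply, shear_of_isHomogeneous f h, map_one, OneMemClass.coe_one, charElem_one_one,
    mul_one]

end Shear

/-! ### Constraints on `u` and `p` from fixing all group-likes -/

section Kernel

variable {k G : Type*} [Field k] [Group G] [Fintype G] [DecidableEq G]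

lemma apply_charElem_one (ψ : HopfAut k G) (χ : G →* kˣ) :
    ψ (charElem χ 1) = ∑ a, (χ a : k) • ψ (basisElem a 1) := by
  simp [charElem]

lemma evalOneTensorId_eq_zero_of_mem_restrictionKer [IsAlgClosed k] [CharZero k]
    {ψ : HopfAut k G} (hψ : ψ ∈ restrictionKer k G) {c : G}
    (hc : c ∉ Subgroup.center G ⊓ commutator G) :
    evalOneTensorId (ψ (basisElem c 1)) = 0 := by
  have hψ' := mem_restrictionKer_iff'.1 hψ
  by_contra h0
  refine hc ⟨mem_center_of_evalOneTensorId_ne_zero hψ'.1 h0,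
    mem_commutator_of_forall_char k fun χ => ?_⟩
  -- Fixing `χ # 1` gives `∑ χ(a) p(e_a) = 1`; multiplying by `p(e_c)` leaves `χ(c) p(e_c) =
  -- p(e_c)`.
  have h1 := congrArg (fun x => evalOneTensorId x * evalOneTensorId (ψ (basisElem c 1))) (hψ'.2 χ)
  simp only [apply_charElem_one, map_sum, map_smul, Finset.sum_mul, smul_mul_assoc,
    evalOneTensorId_mul_self_eq, evalOneTensorId_charElem, map_one, one_mul, smul_ite, smul_zero,
    Finset.sum_ite_eq', Finset.mem_univ, if_true] at h1
  refine Units.ext (smul_left_injective k h0 ?_)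
  simpa using h1

lemma mem_centralAutDerived_of_mem_restrictionKer [IsAlgClosed k] [CharZero k]
    {ψ : HopfAut k G} (hψ : ψ ∈ restrictionKer k G) {α : MulAut G} (hαc : α ∈ centralAut G)
    (hα : ∀ a y, idTensorCounit (ψ (basisElem a 1)) y = if a = α y then 1 else 0) :
    α ∈ centralAutDerived G := by
  refine ⟨hαc, fun g => ⟨by
    have h := hαc g⁻¹
    rw [inv_inv] at h
    exact h, mem_commutator_of_forall_char k fun χ => ?_⟩⟩
  -- Evaluating `u(χ) = χ` at `g⁻¹` gives `χ(α(g⁻¹)) = χ(g⁻¹)`.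
  have h1 := congrArg (fun x => idTensorCounit x g⁻¹) ((mem_restrictionKer_iff'.1 hψ).2 χ)
  simp only [apply_charElem_one, map_sum, map_smul, Finset.sum_apply, Pi.smul_apply, hα,
    idTensorCounit_charElem, smul_eq_mul, mul_ite, mul_one, mul_zero, Finset.sum_ite_eq',
    Finset.mem_univ, if_true] at h1
  rw [map_mul, Units.ext h1, ← map_mul, inv_mul_cancel, map_one]

/-- An automorphism in `Λ_c(G)` with trivial component `u` whose component `p` is supported in a
central subgroup `A` comes from `Hom(A, Z(G))`. -/
theorem exists_shearHom_eq [CharZero k] {A : Subgroup G} [Fintype A]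
    (hA : A ≤ Subgroup.center G) (β : DualPairing k A) {ψ : HopfAut k G} (hψ : ψ ∈ LambdaC k G)
    (hu : ∀ a y, idTensorCounit (ψ (basisElem a 1)) y = if a = y then 1 else 0)
    (hp : ∀ c ∉ A, evalOneTensorId (ψ (basisElem c 1)) = 0) :
    ∃ f : A →* Subgroup.center G, shearHom hA β f = ψ := by
  -- The Fourier transform of `p`: `q m` is the image under `p` of the character of `A` indexed by
  -- `m`, extended by zero to `G`. It will turn out to be the group element `f m`.
  let q : A → MonoidAlgebra k G := fun m =>
    ∑ c : A, (β.toHom m c : k) • evalOneTensorId (ψ (basisElem (c : G) 1))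
  have hP : ∀ c ∉ A, ∀ h, coef 1 h (ψ (basisElem c 1)) = 0 := fun c hc h => by
    rw [← evalOneTensorId_apply, hp c hc]
    simp
  have hsum : ∀ {N : Type _} [AddCommMonoid N] (F : G → N), (∀ c ∉ A, F c = 0) →
      ∑ c : A, F c = ∑ c, F c := fun F hF =>
    Fintype.sum_of_injective _ Subtype.val_injective _ _
      (fun c hc => hF c fun h => hc ⟨⟨c, h⟩, rfl⟩) fun c => rfl
  have hq : ∀ m h, (q m).coeff h =
      ∑ c : A, (β.toHom m c : k) * coef 1 h (ψ (basisElem (c : G) 1)) := fun m h => by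
    simp [q, evalOneTensorId_apply]
  have hqmul : ∀ m m', q (m * m') = q m * q m' := by
    intro m m'
    simp only [q, Finset.sum_mul_sum, smul_mul_smul_comm, evalOneTensorId_mul_self_eq,
      SetLike.coe_eq_coe, smul_ite, smul_zero, Finset.sum_ite_eq, Finset.mem_univ, if_true]
    simp
  -- Coordinate form of `Δ(q m) = q m ⊗ q m`: the character is multiplicative, so the double sum
  -- becomes a convolution to which comultiplicativity of `ψ` applies.
  have hqidem : ∀ m h h', (q m).coeff h * (q m).coeff h' = if h = h' then (q m).coeff h else 0 := by
    intro m h h'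
    simp only [hq, Finset.sum_mul_sum]
    have h1 : ∀ a : A, (∑ c : A, coef 1 h (ψ (basisElem (c : G) 1)) *
        coef 1 h' (ψ (basisElem ((a * c⁻¹ : A) : G) 1))) =
        if h = h' then coef 1 h (ψ (basisElem (a : G) 1)) else 0 := fun a => by
      have h2 := sum_coef_mul_coef ψ (a : G) 1 1 h h'
      rw [← hsum _ fun c hc => by rw [hP c hc, zero_mul]] at h2
      simpa using h2
    have h3 : ∀ c : A, ∑ c' : A,
        (β.toHom m c : k) * coef 1 h (ψ (basisElem (c : G) 1)) *
          ((β.toHom m c' : k) * coef 1 h' (ψ (basisElem (c' : G) 1))) =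
        ∑ a : A, (β.toHom m a : k) * (coef 1 h (ψ (basisElem (c : G) 1)) *
          coef 1 h' (ψ (basisElem ((a * c⁻¹ : A) : G) 1))) := fun c => by
      refine Fintype.sum_equiv (Equiv.mulRight c) _ _ fun c' => ?_
      rw [Equiv.coe_mulRight, mul_inv_cancel_right, map_mul, Units.val_mul]
      ring
    simp only [h3]
    rw [Finset.sum_comm]
    simp only [← Finset.mul_sum, h1]
    split_ifs <;> simp
  -- The counit condition: summing over `h` gives `u(e_c)(1)`, which is `δ_{c,1}` by `hu`.
  have hqsum : ∀ m, ∑ h, (q m).coeff h = 1 := by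
    intro m
    simp only [hq]
    rw [Finset.sum_comm]
    simp only [← Finset.mul_sum, ← idTensorCounit_apply, hu]
    simp
  choose f hf using fun m => exists_eq_ite_of_mul_eq_ite _ (hqidem m) (hqsum m)
  have hqf : ∀ m, q m = MonoidAlgebra.of k G (f m) := fun m => by
    ext h
    rw [hf, MonoidAlgebra.of_apply, MonoidAlgebra.coeff_single, Finsupp.single_apply]
    simp only [eq_comm]
  have hfc : ∀ m, f m ∈ Subgroup.center G := by
    intro m
    have h1 : (q m).coeff (f m) ≠ 0 := by
      rw [hf, if_pos rfl]
      exact one_ne_zero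
    rw [hq] at h1
    obtain ⟨c, -, hc⟩ := Finset.exists_ne_zero_of_sum_ne_zero h1
    exact mem_center_of_coef_one_ne_zero' hψ (right_ne_zero_of_mul hc)
  let F : A →* Subgroup.center G := MonoidHom.mk' (fun m => ⟨f m, hfc m⟩) fun m m' => Subtype.ext
    (MonoidAlgebra.of_injective (R := k) (by
      change MonoidAlgebra.of k G (f (m * m')) = MonoidAlgebra.of k G (f m * f m')
      rw [map_mul, ← hqf, ← hqf, ← hqf, hqmul]))
  refine ⟨F, DFunLike.ext _ _ fun x => ?_⟩
  have key : shear β F =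
      ((ψ : DrinfeldDouble k G →ₐc[k] DrinfeldDouble k G) : DrinfeldDouble k G →ₗ[k] _) := by
    refine lhom_ext fun a b => ?_
    change shearHom hA β F (basisElem a b) = ψ (basisElem a b)
    rw [basisElem_eq_mul, map_mul, map_mul, mem_LambdaC_iff.1 hψ,
      mem_LambdaC_iff.1 (shearHom_mem_LambdaC hA β F)]
    congr 1
    refine ext_coef fun y h => ?_
    -- Fourier inversion: `p` is recovered from `f`. The inverse on `c` comes from using the same
    -- character in both directions.
    have hbij : ∀ c : A, ∑ m, ((β.toHom m c : k) * if f m = h then 1 else 0) =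
        Fintype.card A * coef 1 h (ψ (basisElem (c : G)⁻¹ 1)) := by
      intro c
      have h1 : ∀ m, (if f m = h then 1 else 0 : k) = (q m).coeff h := fun m => by
        rw [hf]
        simp only [eq_comm]
      simp only [h1, hq, Finset.mul_sum]
      rw [Finset.sum_comm]
      simp only [← mul_assoc, ← Finset.sum_mul, ← Units.val_mul, ← map_mul, β.sum_left]
      simp only [mul_eq_one_iff_inv_eq, ite_mul, zero_mul, Finset.sum_ite_eq, Finset.mem_univ,
        if_true, InvMemClass.coe_inv]
    rw [shearHom_apply, shear_apply, map_sum]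
    simp only [coef_proj_mul_charElem_one]
    rw [← Finset.mul_sum, Finset.sum_comm]
    have h2 : ∀ c : A, ∑ m, ((β.toHom m c : k) * if a * (c : G) = y ∧ (F m : G) = h then 1 else 0) =
        if a * (c : G) = y then
          (Fintype.card A : k) * coef 1 h (ψ (basisElem (c : G)⁻¹ 1)) else 0 := fun c => by
      rw [← hbij c]
      by_cases hc : a * (c : G) = y
      · simp only [hc, true_and, if_true]
        rfl
      · simp [hc]
    simp only [h2]
    rw [hsum (fun c => if a * c = y then
      (Fintype.card A : k) * coef 1 h (ψ (basisElem c⁻¹ 1)) else 0) fun c hc => by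
        rw [hP _ (mt inv_mem_iff.1 hc), mul_zero, ite_self]]
    -- With `u` trivial, the reconstruction of `ψ(e_a # 1)` matches the shear coefficient after `c ↦
    -- c⁻¹`.
    rw [← coef_eq_sum_right ψ a y h]
    rw [Finset.mul_sum]
    refine Fintype.sum_equiv (Equiv.inv G) _ _ fun c => ?_
    rw [hu, Equiv.inv_apply, inv_inv]
    split_ifs
    · rw [inv_mul_cancel_left₀ (card_ne_zero k A), one_mul]
    · rw [mul_zero, zero_mul]
  exact LinearMap.congr_fun key x

end Kernel

lemma eq_inl_of_right_eq_one {G : Type*} [Group G]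
    {s : CenterHom G ⋊[centralAutDerivedAction G] centralAutDerived G}
    (hs : s.right = 1) : s = SemidirectProduct.inl s.left :=
  SemidirectProduct.ext rfl hs

/-! ### Assembling twists and shears into the isomorphism with `N` -/

section SemidirectProduct

variable {k G : Type*} [Field k] [Group G] [Fintype G] [DecidableEq G]

lemma HopfAut.mul_apply (φ ψ : HopfAut k G) (x : DrinfeldDouble k G) : (φ * ψ) x = φ (ψ x) := rfl

variable [CharZero k]

lemma centralAutDerived_le_centralAut (G : Type*) [Group G] :
    centralAutDerived G ≤ centralAut G := fun _ hw => hw.1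

variable [Fintype ↥(Subgroup.center G ⊓ commutator G)]
  (β : DualPairing k ↥(Subgroup.center G ⊓ commutator G))

/-- The embedding of `Hom(Z(G) ∩ G', Z(G))` into `Aut(D(G))`. -/
noncomputable def centerHomHom : CenterHom G →* HopfAut k G := shearHom inf_le_left β

lemma centerHomHom_apply (f : CenterHom G) (x : DrinfeldDouble k G) :
    centerHomHom β f x = shear β f x := rfl

lemma twistHom_mul_centerHomHom (w : centralAut G) (f : CenterHom G) :
    twistHom w * centerHomHom β f = centerHomHom β f * twistHom w := by
  refine DFunLike.ext _ _ fun x => ?_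
  rw [HopfAut.mul_apply, HopfAut.mul_apply, twistHom_apply, twistHom_apply, centerHomHom_apply,
    centerHomHom_apply]
  exact twist_shear (fun c : ↥(Subgroup.center G ⊓ commutator G) =>
    centralAut_apply_of_mem_commutator w.2 (Subgroup.mem_inf.1 c.2).2) β f x

/-- The homomorphism from `Hom(Z(G) ∩ G', Z(G)) ⋊ Aut_{c'}(G)` to `Aut(D(G))`. -/
noncomputable def semidirectHom :
    CenterHom G ⋊[centralAutDerivedAction G] centralAutDerived G →* HopfAut k G :=
  SemidirectProduct.lift (centerHomHom β)
    (twistHom.comp (Subgroup.inclusion (centralAutDerived_le_centralAut G))) fun w => by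
      refine MonoidHom.ext fun f => ?_
      rw [MonoidHom.comp_apply, MonoidHom.comp_apply, MulEquiv.toMonoidHom_eq_coe,
        MulEquiv.toMonoidHom_eq_coe, MonoidHom.coe_coe, MonoidHom.coe_coe,
        centralAutDerivedAction_apply, MulAut.conj_apply, MonoidHom.comp_apply,
        twistHom_mul_centerHomHom, mul_inv_cancel_right]

lemma semidirectHom_apply
    (s : CenterHom G ⋊[centralAutDerivedAction G] centralAutDerived G) (x : DrinfeldDouble k G) :
    semidirectHom β s x = shear β s.left (twist (s.right : MulAut G) x) := rfl

lemma semidirectHom_mem (s : CenterHom G ⋊[centralAutDerivedAction G] centralAutDerived G) :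
    semidirectHom β s ∈ restrictionKer k G :=
  mul_mem (shearHom_mem_restrictionKer inf_le_left inf_le_right β s.left)
    (twistHom_mem_restrictionKer s.right.2)

lemma idTensorCounit_semidirectHom
    (s : CenterHom G ⋊[centralAutDerivedAction G] centralAutDerived G) (g h : G) :
    idTensorCounit (semidirectHom β s (basisElem g h)) = Pi.single ((s.right : MulAut G) g) 1 := by
  rw [semidirectHom_apply, idTensorCounit_shear, twist_basisElem, idTensorCounit_basisElem]

lemma right_eq_one_of_idTensorCounit
    {s : CenterHom G ⋊[centralAutDerivedAction G] centralAutDerived G}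
    (hs : ∀ g, idTensorCounit (semidirectHom β s (basisElem g 1)) = Pi.single g 1) :
    s.right = 1 := by
  refine Subtype.ext (MulEquiv.ext fun g => ?_)
  have h := congrFun ((idTensorCounit_semidirectHom β s g 1).symm.trans (hs g)) g
  by_contra hne
  have hne' : g ≠ (s.right : MulAut G) g := fun e => hne e.symm
  simp [hne'] at h

lemma semidirectHom_injective : Function.Injective (semidirectHom β) := by
  refine (injective_iff_map_eq_one _).2 fun s hs => ?_
  have hr : s.right = 1 := right_eq_one_of_idTensorCounit β fun g => by
    rw [hs]
    exact idTensorCounit_basisElem g 1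
  rw [eq_inl_of_right_eq_one hr] at hs ⊢
  have hl : shearHom inf_le_left β s.left = 1 := by
    rwa [semidirectHom, SemidirectProduct.lift_inl] at hs
  rw [shearHom_injective inf_le_left β (hl.trans (map_one _).symm)]
  exact map_one _

lemma exists_semidirectHom_eq [IsAlgClosed k] {ψ : HopfAut k G} (hψ : ψ ∈ restrictionKer k G) :
    ∃ s, semidirectHom β s = ψ := by
  have hψ' := (mem_restrictionKer_iff'.1 hψ).1
  obtain ⟨α, hαc, hα⟩ := exists_centralAut hψ'
  have hαd := mem_centralAutDerived_of_mem_restrictionKer hψ hαc hα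
  let t : HopfAut k G := twistHom ⟨α, hαc⟩
  have ht : t ∈ restrictionKer k G := twistHom_mem_restrictionKer hαd
  have hmem := mul_mem hψ ht
  have hmem' := (mem_restrictionKer_iff'.1 hmem).1
  -- The product `ψ * t` has trivial `u`, because `u` of `ψ` tests `α a = α y`. It still lies in
  -- `N`, so its `p` is supported in `Z(G) ∩ G'`.
  obtain ⟨f, hf⟩ := exists_shearHom_eq inf_le_left β hmem' (fun a y => by
      change idTensorCounit (ψ (twist α (basisElem a 1))) y = _
      rw [twist_basisElem, hα]
      simp only [EmbeddingLike.apply_eq_iff_eq])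
    fun c hc => evalOneTensorId_eq_zero_of_mem_restrictionKer hmem hc
  -- The shear equals `ψ * t`, hence the inverse in the second factor.
  refine ⟨SemidirectProduct.inl f * SemidirectProduct.inr ⟨α, hαd⟩⁻¹, ?_⟩
  rw [map_mul, semidirectHom, SemidirectProduct.lift_inl, SemidirectProduct.lift_inr, map_inv]
  refine (congrArg (· * t⁻¹) hf).trans ?_
  exact mul_inv_cancel_right ψ t

/-- The isomorphism between `Hom(Z(G) ∩ G', Z(G)) ⋊ Aut_{c'}(G)` and `N`. -/
noncomputable def semidirectEquiv [IsAlgClosed k] :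
    CenterHom G ⋊[centralAutDerivedAction G] centralAutDerived G ≃* restrictionKer k G :=
  MulEquiv.ofBijective ((semidirectHom β).codRestrict (restrictionKer k G) (semidirectHom_mem β))
    ⟨fun _ _ h => semidirectHom_injective β (congrArg Subtype.val h), fun n => by
      obtain ⟨s, hs⟩ := exists_semidirectHom_eq β n.2
      exact ⟨s, Subtype.ext hs⟩⟩

lemma semidirectHom_mem_Lambda_iff
    (s : CenterHom G ⋊[centralAutDerivedAction G] centralAutDerived G) :
    semidirectHom β s ∈ Lambda k G ↔ s.right = 1 := by
  have hc : semidirectHom β s ∈ LambdaC k G :=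
    (mem_restrictionKer_iff'.1 (semidirectHom_mem β s)).1
  constructor
  · rintro ⟨-, hu⟩
    refine right_eq_one_of_idTensorCounit β fun g => ?_
    rw [← u_idTensorCounit hc, hu, idTensorCounit_basisElem]
  · refine fun hr => ⟨hc, fun a => ?_⟩
    obtain ⟨x, rfl⟩ := idTensorCounit_surjective a
    rw [u_idTensorCounit hc, semidirectHom_apply, idTensorCounit_shear, hr]
    exact congrArg _ (twist_one x)

end SemidirectProduct

/-! ### Triviality of `N` and its comparison with `Λ_c(G)` -/

section MainResults

variable {k G : Type*} [Field k] [IsAlgClosed k] [CharZero k] [Group G] [Fintype G] [DecidableEq G]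

lemma nonempty_dualPairing_of_le_center {k G : Type*} [Field k] [IsAlgClosed k] [CharZero k]
    [Group G] [Finite G] {A : Subgroup G} (hA : A ≤ Subgroup.center G) :
    Nonempty (DualPairing k A) :=
  nonempty_dualPairing k A fun a b => Subtype.ext (Subgroup.mem_center_iff.1 (hA b.2) a)

lemma restrictionKer_eq_bot_iff :
    restrictionKer k G = ⊥ ↔ Subgroup.center G ⊓ commutator G = ⊥ := by
  have := Fintype.ofFinite ↥(Subgroup.center G ⊓ commutator G)
  obtain ⟨β⟩ := nonempty_dualPairing_of_le_center (k := k)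
    (inf_le_left : Subgroup.center G ⊓ commutator G ≤ _)
  constructor
  · intro h
    -- The inclusion is trivial only if `Z(G) ∩ G'` is, so its shear detects the whole intersection.
    let f : CenterHom G := Subgroup.inclusion inf_le_left
    have hf := shearHom_mem_restrictionKer inf_le_left inf_le_right β f
    rw [h, Subgroup.mem_bot, ← map_one (shearHom inf_le_left β)] at hf
    have h1 : f = 1 := shearHom_injective inf_le_left β hf
    refine (Subgroup.eq_bot_iff_forall _).2 fun x hx => ?_
    exact congrArg Subtype.val (DFunLike.congr_fun h1 ⟨x, hx⟩)
  · intro h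
    refine (Subgroup.eq_bot_iff_forall _).2 fun ψ hψ => ?_
    obtain ⟨s, rfl⟩ := exists_semidirectHom_eq β hψ
    have h1 : s.right = 1 := Subtype.ext (MulEquiv.ext fun g => by
      have h2 := s.right.2.2 g⁻¹
      rw [h, Subgroup.mem_bot, inv_inv, mul_inv_eq_one] at h2
      exact h2)
    have h2 : s.left = 1 := MonoidHom.ext fun m => by
      have : m = 1 := Subtype.ext ((Subgroup.eq_bot_iff_forall _).1 h m m.2)
      rw [this, map_one, map_one]
    have h3 : s = 1 := SemidirectProduct.ext h2 h1
    rw [h3, map_one]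

lemma center_le_commutator_iff :
    Subgroup.center G ≤ commutator G ↔
      (restrictionKer k G : Set (HopfAut k G)) = LambdaC k G := by
  constructor
  · intro hZ
    ext ψ
    rw [SetLike.mem_coe, mem_restrictionKer_iff', and_iff_left_iff_imp]
    intro hψ χ
    obtain ⟨α, hαc, hα⟩ := exists_centralAut hψ
    refine ext_coef fun y h => ?_
    have hχα : χ (α y) = χ y := by
      have := char_eq_one_of_mem_commutator (hZ (hαc y)) χ
      rwa [map_mul, map_inv, mul_inv_eq_one] at this
    -- On the support of `p` the element `a * (α y)⁻¹` is central, hence in `G'`, so `χ a = χ (α y)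
    -- = χ y` comes out of the sum; what remains is `p(1) = 1`.
    have hP : ∀ a, (χ a : k) * coef y h (ψ (basisElem a 1)) =
        (χ y : k) * coef 1 h (ψ (basisElem (a * (α y)⁻¹) 1)) := by
      intro a
      rw [coef_eq_of_idTensorCounit_eq hα]
      by_cases h0 : coef 1 h (ψ (basisElem (a * (α y)⁻¹) 1)) = 0
      · rw [h0, mul_zero, mul_zero]
      · have := char_eq_one_of_mem_commutator (hZ (mem_center_of_coef_one_ne_zero hψ h0)) χ
        rw [map_mul, map_inv, hχα, mul_inv_eq_one] at this
        rw [this]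
    simp only [apply_charElem_one, map_sum, map_smul, smul_eq_mul, hP, ← Finset.mul_sum]
    rw [Fintype.sum_equiv (Equiv.mulRight (α y)⁻¹)
      (fun c => coef 1 h (ψ (basisElem (c * (α y)⁻¹) 1)))
      (fun c => coef 1 h (ψ (basisElem c 1))) fun _ => rfl, ← map_sum, ← map_sum, ← one_def, map_one,
      ← charElem_one_one, coef_charElem, coef_charElem]
    simp
  · intro h
    have := Fintype.ofFinite (Subgroup.center G)
    obtain ⟨β⟩ := nonempty_dualPairing_of_le_center (k := k) (le_refl (Subgroup.center G))
    -- This shear sends `χ # 1` to `χ # m`, where `m` indexes the restriction of `χ` to `Z(G)`.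
    -- Being in `N` forces `m = 1`, so `χ` is trivial on the centre.
    have hf : shearHom le_rfl β (MonoidHom.id _) ∈ (restrictionKer k G : Set (HopfAut k G)) :=
      h ▸ shearHom_mem_LambdaC le_rfl β _
    intro z hz
    refine mem_commutator_of_forall_char k fun χ => ?_
    obtain ⟨m, hm⟩ := β.bijective.2 (χ.comp (Subgroup.center G).subtype)
    have h1 := mem_restrictionKer_iff.1 hf χ 1
    have hχ : IsHomogeneous β m (charElem χ 1) := isHomogeneous_charElem 1 fun c => by
      rw [hm]; rfl
    rw [shearHom_apply, shear_of_isHomogeneous _ hχ, ← charElem_eq_mul] at h1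
    have h2 : (m : G) = 1 := congrArg Prod.snd (toGroupLike_injective (k := k)
      (a₁ := (χ, (m : G))) (a₂ := (χ, 1)) (GroupLike.val_injective h1))
    rw [Subtype.ext h2 (a1 := m) (a2 := 1), map_one] at hm
    exact (DFunLike.congr_fun hm ⟨z, hz⟩).symm

end MainResults

end DrinfeldDouble

theorem mainTheorem8 {k G : Type*} [Field k] [IsAlgClosed k] [CharZero k]
    [Group G] [Fintype G] [DecidableEq G] :
    (∃ e : DrinfeldDouble.restrictionKer k G ≃*
        CenterHom G ⋊[centralAutDerivedAction G] centralAutDerived G,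
      (∀ (w : centralAutDerived G) (g h : G),
        (e.symm (SemidirectProduct.inr w) : DrinfeldDouble.HopfAut k G)
            (DrinfeldDouble.basisElem g h) =
          DrinfeldDouble.basisElem ((w : MulAut G) g) h) ∧
      (∀ n : DrinfeldDouble.restrictionKer k G,
        (n : DrinfeldDouble.HopfAut k G) ∈ DrinfeldDouble.Lambda k G ↔
          ∃ f : CenterHom G, e n = SemidirectProduct.inl f)) ∧
    (DrinfeldDouble.restrictionKer k G = ⊥ ↔ Subgroup.center G ⊓ commutator G = ⊥) ∧
    ((∀ a b : G, a * b = b * a) → DrinfeldDouble.restrictionKer k G = ⊥) ∧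
    (Subgroup.center G = ⊥ → DrinfeldDouble.restrictionKer k G = ⊥) ∧
    (Subgroup.center G ≤ commutator G ↔
      (DrinfeldDouble.restrictionKer k G : Set (DrinfeldDouble.HopfAut k G)) =
        DrinfeldDouble.LambdaC k G) ∧
    (Subgroup.center G ≤ commutator G →
      (DrinfeldDouble.restrictionKer k G ≠ ⊥ ↔ Subgroup.center G ≠ ⊥)) := by
  refine ⟨?_, DrinfeldDouble.restrictionKer_eq_bot_iff, fun hG => ?_, fun hZ => ?_,
    DrinfeldDouble.center_le_commutator_iff, fun hZ => ?_⟩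
  · have := Fintype.ofFinite ↥(Subgroup.center G ⊓ commutator G)
    obtain ⟨β⟩ := DrinfeldDouble.nonempty_dualPairing_of_le_center (k := k)
      (inf_le_left : Subgroup.center G ⊓ commutator G ≤ _)
    refine ⟨(DrinfeldDouble.semidirectEquiv β).symm, fun w g h => ?_, fun n => ?_⟩
    · change DrinfeldDouble.semidirectHom β (SemidirectProduct.inr w)
        (DrinfeldDouble.basisElem g h) = _
      rw [DrinfeldDouble.semidirectHom, SemidirectProduct.lift_inr]
      exact DrinfeldDouble.twist_basisElem _ g h
    · obtain ⟨s, rfl⟩ := (DrinfeldDouble.semidirectEquiv β).surjective n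
      rw [MulEquiv.symm_apply_apply]
      refine (DrinfeldDouble.semidirectHom_mem_Lambda_iff β s).trans
        ⟨fun hs => ⟨s.left, DrinfeldDouble.eq_inl_of_right_eq_one hs⟩, ?_⟩
      rintro ⟨f, rfl⟩
      exact SemidirectProduct.right_inl f
  · have h : commutator G = ⊥ := by
      rw [commutator_def, Subgroup.commutator_eq_bot_iff_le_centralizer]
      exact fun x _ => Subgroup.mem_centralizer_iff.2 fun y _ => hG y x
    rw [DrinfeldDouble.restrictionKer_eq_bot_iff, h, inf_bot_eq]
  · rw [DrinfeldDouble.restrictionKer_eq_bot_iff, hZ, bot_inf_eq]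
  · rw [ne_eq, DrinfeldDouble.restrictionKer_eq_bot_iff, inf_eq_left.2 hZ]
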